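/- **Setting.** For $\beta\in[0,1]$, $m>0$ and $\sigma\ge 0$, let $\mathcal M_\beta(m,\sigma^{\beta+1})$ be the class of Borel probability measures $\mu$ on $\mathbb R$ such that $$\nu^+([x,\infty))\le \sigma^{\beta+1}\mu([x,\infty))\quad\text{for all }x\ge m,\qquad \nu^-((-\infty,x])\le \sigma^{\beta+1}\mu((-\infty,x])\quad\text{for all }x\le -m,$$ where $\nu^+$ is the measure on $[m,\infty)$ with Lebesgue density $x^\beta\mu([x,\infty))$ and $\nu^-$ is the measure on $(-\infty,-m]$ with Lebesgue density $|x|^\beta\mu((-\infty,x])$. For a nonnegative random variable $Y$ put $\operatorname{Ent}Y=\mathbb E\,Y\log Y-\mathbb E Y\,\log\mathbb E Y$ if $\mathbb E\,Y\log Y<\infty$, and $\operatorname{Ent}Y=\infty$ otherwise. For $x\in\mathbb R^n$ let $\|x\|_p=(\sum_{i=1}^n|x_i|^p)^{1/p}$ and $|x|=\|x\|_2$. **Theorem 1.3.** Let $\beta\in[0,1]$, $m>0$ and $\sigma\ge0$. There is a constant $C=C(\beta,m,\sigma)\in(0,\infty)$, depending only on $\beta$, $m$ and $\sigma$ (in particular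 not on $n$), such that the following holds for every $n$, all independent real random variables $X_1,\dots,X_n$ whose laws belong to $\mathcal M_\beta(m,\sigma^{\beta+1})$, and every smooth ($C^\infty$) convex function $\varphi\colon\mathbb R^n\to\mathbb R$. Write $X=(X_1,\dots,X_n)$. 1. If $\beta\in(0,1]$, then $$\operatorname{Ent}e^{\varphi(X)}\le C\;\mathbb E\Big[\Big(|\nabla\varphi(X)|^2\vee\|\nabla\varphi(X)\|_{\frac{\beta+1}{\beta}}^{\frac{\beta+1}{\beta}}\Big)e^{\varphi(X)}\Big].$$ 2. If $\beta=0$ and $|\partial_i\varphi(x)|\le \frac1{2(m+3\sigma)}$ for all $i\in\{1,\dots,n\}$ and all $x\in\mathbb R^n$, then $$\operatorname{Ent}e^{\varphi(X)}\le C\;\mathbb E\big[|\nabla\varphi(X)|^2e^{\varphi(X)}\big].$$ Both sides of these inequalities may be $+\infty$. -/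

import Mathlib

open MeasureTheory ProbabilityTheory
open scoped ENNReal

noncomputable section

namespace ModLogSob

/-- The measure `ν⁺` on `[m, ∞)` with Lebesgue density `x ↦ x ^ β * μ([x, ∞))`. -/
def nuPlus (β m : ℝ) (μ : Measure ℝ) : Measure ℝ :=
  (volume.restrict (Set.Ici m)).withDensity
    (fun x => ENNReal.ofReal (x ^ β) * μ (Set.Ici x))

/-- The measure `ν⁻` on `(-∞, -m]` with Lebesgue density `x ↦ |x| ^ β * μ((-∞, x])`. -/
def nuMinus (β m : ℝ) (μ : Measure ℝ) : Measure ℝ :=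
  (volume.restrict (Set.Iic (-m))).withDensity
    (fun x => ENNReal.ofReal (|x| ^ β) * μ (Set.Iic x))

/-- `ClassM β m s μ` says that `μ` is a probability distribution on `ℝ` belonging to the class
`M_β(m, s)`; the theorem uses it with `s = σ ^ (β + 1)`. -/
structure ClassM (β m s : ℝ) (μ : Measure ℝ) : Prop where
  isProbabilityMeasure : IsProbabilityMeasure μ
  right_tail : ∀ x : ℝ, m ≤ x →
    nuPlus β m μ (Set.Ici x) ≤ ENNReal.ofReal s * μ (Set.Ici x)
  left_tail : ∀ x : ℝ, x ≤ -m →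
    nuMinus β m μ (Set.Iic x) ≤ ENNReal.ofReal s * μ (Set.Iic x)

open Classical in
/-- The entropy `Ent Y = E[Y log Y] - E[Y] log E[Y]` of a nonnegative random variable `Y`
if `E[Y log Y] < ∞`, and `Ent Y = ∞` otherwise. As `y log y ≥ -1/e` for `y ≥ 0`,
under a probability measure `E[Y log Y] < ∞` means that `Y log Y` is integrable
(and then `Y` is integrable too). -/
def Ent {Ω : Type*} [MeasurableSpace Ω] (P : Measure Ω) (Y : Ω → ℝ) : EReal :=
  if Integrable (fun ω => Y ω * Real.log (Y ω)) P then
    (((∫ ω, Y ω * Real.log (Y ω) ∂P) - (∫ ω, Y ω ∂P) * Real.log (∫ ω, Y ω ∂P) : ℝ) : EReal)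
  else ⊤

/-- The `ℓ_p` norm `(∑ |x_i| ^ p) ^ (1 / p)` on `ℝⁿ`. -/
def lpNorm {n : ℕ} (p : ℝ) (x : EuclideanSpace ℝ (Fin n)) : ℝ :=
  (∑ i, |x i| ^ p) ^ (1 / p)

/-- The random vector `(X_1, …, X_n)`. -/
def vec {Ω : Type*} {n : ℕ} (X : Fin n → Ω → ℝ) (ω : Ω) : EuclideanSpace ℝ (Fin n) :=
  WithLp.toLp 2 (fun i => X i ω)

end ModLogSob

end

/-! Write B_c(F) = e^F (F - c) - e^F + e^c, the Bregman divergence of exp. For every c, Ent e^f ≤ E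
B_c(f), with equality at c = log E e^f when f is bounded. Entropy is subadditive over product
measures, so it suffices to bound E B_c(f) for a convex f on the line and one suitable c, with a
constant depending only on the class.

On the line, replace m by a radius R such that [-R, R] has mass at least 1/2. Let y₀ minimise f on
[-R, R] and put c = f(y₀). On the right tail G = B_c(max(f, c)) is nondecreasing with G' = e^f (f -
c) f' where f > c. With w = f - c one has G = e^f θ(w), θ(w) = w - 1 + e^{-w}, and convexity gives w
≤ 2 t f'. A pointwise inequality (`mul_le_theta_of_pos`, or `mul_le_theta_of_le` for β = 0) yields
G' ≤ t^β (δ G + K e^f d(f')), where d(y) is y² or y² ∨ y^{(β+1)/β}. Integrate G' against the tail of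
μ. The class condition compares ν⁺ with μ on half-lines, hence on nondecreasing functions, so the
δ-term is at most δ s ∫ G dμ ≤ (1/2) ∫ G dμ and is absorbed (`setLIntegral_le_of_deriv_le`). The
left tail follows by reflection, and [-R, R] is elementary.

Where f < c, the tangent at y₀ bounds B_c(f) by e^c f'(y₀)² (t - y₀)². The second moment is bounded
over the class, and e^c f'(y₀)² is at most e^f f'² throughout [-R, R], a set of mass at least 1/2.

Tensorisation is done for bounded functions. Truncating φ destroys convexity, but clamping both
arguments does not increase B, so the sectional estimates survive. Compactness of the base points
and Fatou then remove the truncation. -/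

namespace ModLogSob

/-! ### Tail comparison and differential inequalities on a half-line -/

/-- Comparison of two measures on half-lines passes to all upper sets. -/
theorem measure_le_of_Ici_le {ν μ : Measure ℝ} {κ : ℝ≥0∞} {m : ℝ}
    (h : ∀ x, m ≤ x → ν (Set.Ici x) ≤ κ * μ (Set.Ici x)) {S : Set ℝ}
    (hS : S ⊆ Set.Ici m) (hup : ∀ x ∈ S, ∀ y, x ≤ y → y ∈ S) : ν S ≤ κ * μ S := by
  rcases S.eq_empty_or_nonempty with rfl | hne
  · simp
  have hbdd : BddBelow S := ⟨m, fun x hx => hS hx⟩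
  by_cases ha : sInf S ∈ S
  · have : S = Set.Ici (sInf S) :=
      Set.Subset.antisymm (fun x hx => csInf_le hbdd hx) (fun x hx => hup _ ha _ hx)
    have h' := h _ (hS ha)
    rwa [← this] at h'
  · have hU : S = ⋃ n : ℕ, Set.Ici (sInf S + 1 / ((n : ℝ) + 1)) := by
      ext x
      simp only [Set.mem_iUnion, Set.mem_Ici]
      constructor
      · intro hx
        have hlt : sInf S < x :=
          lt_of_le_of_ne (csInf_le hbdd hx) (fun e => ha (e ▸ hx))
        obtain ⟨n, hn⟩ := exists_nat_one_div_lt (sub_pos.2 hlt)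
        exact ⟨n, by linarith⟩
      · rintro ⟨n, hn⟩
        have hpos : (0 : ℝ) < 1 / ((n : ℝ) + 1) := by positivity
        obtain ⟨y, hy, hyx⟩ := exists_lt_of_csInf_lt hne
          (show sInf S < x by linarith)
        exact hup y hy x hyx.le
    have hmono : Monotone fun n : ℕ => Set.Ici (sInf S + 1 / ((n : ℝ) + 1)) := by
      intro i j hij
      apply Set.Ici_subset_Ici.2
      have : 1 / ((j : ℝ) + 1) ≤ 1 / ((i : ℝ) + 1) := by gcongr
      linarith
    have key : ν (⋃ n : ℕ, Set.Ici (sInf S + 1 / ((n : ℝ) + 1))) ≤ κ * μ S := by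
      rw [hmono.measure_iUnion]
      refine iSup_le fun n => ?_
      have hsub : Set.Ici (sInf S + 1 / ((n : ℝ) + 1)) ⊆ S := by
        conv_rhs => rw [hU]
        exact Set.subset_iUnion (fun n : ℕ => Set.Ici (sInf S + 1 / ((n : ℝ) + 1))) n
      refine (h _ (hS (hsub Set.self_mem_Ici))).trans ?_
      gcongr
    rwa [← hU] at key

/-- Comparison of two measures on half-lines passes to integrals of nondecreasing functions. -/
theorem setLIntegral_le_of_monotoneOn {ν μ : Measure ℝ} {κ : ℝ≥0∞} (hκ : κ ≠ ⊤) {m : ℝ}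
    (h : ∀ x, m ≤ x → ν (Set.Ici x) ≤ κ * μ (Set.Ici x)) {g : ℝ → ℝ}
    (hg : MonotoneOn g (Set.Ici m)) (hg0 : ∀ x, m ≤ x → 0 ≤ g x) :
    ∫⁻ x in Set.Ici m, ENNReal.ofReal (g x) ∂ν
      ≤ κ * ∫⁻ x in Set.Ici m, ENNReal.ofReal (g x) ∂μ := by
  have hae : ∀ ρ : Measure ℝ, 0 ≤ᵐ[ρ.restrict (Set.Ici m)] g := fun ρ =>
    (ae_restrict_mem measurableSet_Ici).mono fun x hx => hg0 x hx
  rw [lintegral_eq_lintegral_meas_lt _ (hae ν)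
      (aemeasurable_restrict_of_monotoneOn measurableSet_Ici hg),
    lintegral_eq_lintegral_meas_lt _ (hae μ)
      (aemeasurable_restrict_of_monotoneOn measurableSet_Ici hg),
    ← lintegral_const_mul' _ _ hκ]
  refine lintegral_mono fun t => ?_
  simp only [Measure.restrict_apply' measurableSet_Ici]
  -- Superlevel sets of a nondecreasing function are upper sets within [m, ∞).
  refine measure_le_of_Ici_le h Set.inter_subset_right ?_
  rintro x ⟨hx, hxm⟩ y hxy
  exact ⟨lt_of_lt_of_le hx (hg hxm (le_trans (Set.mem_Ici.1 hxm) hxy) hxy),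
    le_trans (Set.mem_Ici.1 hxm) hxy⟩

theorem measurable_measure_Ici (μ : Measure ℝ) : Measurable fun x => μ (Set.Ici x) :=
  Antitone.measurable fun _ _ h => measure_mono (Set.Ici_subset_Ici.2 h)

theorem measurable_nuPlus_density (β : ℝ) (μ : Measure ℝ) :
    Measurable fun x : ℝ => ENNReal.ofReal (x ^ β) * μ (Set.Ici x) :=
  (by fun_prop : Measurable fun x : ℝ => ENNReal.ofReal (x ^ β)).mul (measurable_measure_Ici μ)

/-- Hardy-type inequality for nondecreasing functions. -/
theorem setLIntegral_tail_le {β m s : ℝ} {μ : Measure ℝ}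
    (h : ∀ x, m ≤ x → nuPlus β m μ (Set.Ici x) ≤ ENNReal.ofReal s * μ (Set.Ici x)) {g : ℝ → ℝ}
    (hg : MonotoneOn g (Set.Ici m)) (hg0 : ∀ x, m ≤ x → 0 ≤ g x) :
    ∫⁻ x in Set.Ici m, ENNReal.ofReal (x ^ β) * μ (Set.Ici x) * ENNReal.ofReal (g x)
      ≤ ENNReal.ofReal s * ∫⁻ x in Set.Ici m, ENNReal.ofReal (g x) ∂μ := by
  have := setLIntegral_le_of_monotoneOn ENNReal.ofReal_ne_top h hg hg0
  rw [nuPlus, restrict_withDensity measurableSet_Ici, Measure.restrict_restrict measurableSet_Ici,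
    Set.inter_self, lintegral_withDensity_eq_lintegral_mul₀
      (measurable_nuPlus_density β μ).aemeasurable
      (aemeasurable_restrict_of_monotoneOn measurableSet_Ici hg).ennreal_ofReal] at this
  exact this

/-- Layer-cake bound for the integral of a truncated nondecreasing `C¹` function. -/
theorem setLIntegral_min_le {m R : ℝ} (hmR : m ≤ R) {μ : Measure ℝ} [IsProbabilityMeasure μ]
    {G G' : ℝ → ℝ} (hG : ∀ t, HasDerivAt G (G' t) t) (hG' : Continuous G')
    (hG'0 : ∀ t, m ≤ t → 0 ≤ G' t) :
    ∫⁻ t in Set.Ici m, ENNReal.ofReal (G (min t R)) ∂μ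
      ≤ ENNReal.ofReal (G m) * μ (Set.Ici m)
        + ∫⁻ r in Set.Icc m R, ENNReal.ofReal (G' r) * μ (Set.Ici r) := by
  have hpt : ∀ t ∈ Set.Ici m, ENNReal.ofReal (G (min t R)) ≤ ENNReal.ofReal (G m)
      + ∫⁻ r in Set.Icc m R, Set.indicator {p : ℝ × ℝ | p.2 ≤ p.1}
          (fun p => ENNReal.ofReal (G' p.2)) (t, r) := by
    intro t ht
    have hle : m ≤ min t R := le_min ht hmR
    have h1 : G (min t R) = G m + ∫ r in m..(min t R), G' r := by
      rw [intervalIntegral.integral_eq_sub_of_hasDerivAt (fun x _ => hG x)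
        (hG'.intervalIntegrable _ _)]
      ring
    rw [h1, intervalIntegral.integral_of_le hle]
    refine ENNReal.ofReal_add_le.trans ?_
    gcongr
    rw [ofReal_integral_eq_lintegral_ofReal
      (hG'.integrableOn_Icc.mono_set Set.Ioc_subset_Icc_self)
      ((ae_restrict_mem measurableSet_Ioc).mono fun x hx => hG'0 x hx.1.le)]
    rw [← lintegral_indicator measurableSet_Ioc, ← lintegral_indicator measurableSet_Icc]
    refine lintegral_mono fun r => ?_
    by_cases hr : r ∈ Set.Ioc m (min t R)
    · have h2 : r ∈ Set.Icc m R := ⟨hr.1.le, hr.2.trans (min_le_right _ _)⟩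
      have h3 : r ≤ t := hr.2.trans (min_le_left _ _)
      simp [hr, h2, h3]
    · simp [Set.indicator_of_notMem hr]
  have hmeas : Measurable (Set.indicator {p : ℝ × ℝ | p.2 ≤ p.1}
      (fun p => ENNReal.ofReal (G' p.2))) := by
    refine Measurable.indicator ?_ (measurableSet_le measurable_snd measurable_fst)
    have := hG'.measurable
    fun_prop
  calc ∫⁻ t in Set.Ici m, ENNReal.ofReal (G (min t R)) ∂μ
      ≤ ∫⁻ t in Set.Ici m, (ENNReal.ofReal (G m)
        + ∫⁻ r in Set.Icc m R, Set.indicator {p : ℝ × ℝ | p.2 ≤ p.1}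
          (fun p => ENNReal.ofReal (G' p.2)) (t, r)) ∂μ :=
        setLIntegral_mono' measurableSet_Ici hpt
    _ = ENNReal.ofReal (G m) * μ (Set.Ici m) + ∫⁻ t in Set.Ici m,
        ∫⁻ r in Set.Icc m R, Set.indicator {p : ℝ × ℝ | p.2 ≤ p.1}
          (fun p => ENNReal.ofReal (G' p.2)) (t, r) ∂volume ∂μ := by
        rw [lintegral_add_left measurable_const]
        simp
    _ = ENNReal.ofReal (G m) * μ (Set.Ici m) + ∫⁻ r in Set.Icc m R,
        ∫⁻ t in Set.Ici m, Set.indicator {p : ℝ × ℝ | p.2 ≤ p.1}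
          (fun p => ENNReal.ofReal (G' p.2)) (t, r) ∂μ := by
        rw [lintegral_lintegral_swap]
        exact hmeas.aemeasurable
    _ ≤ _ := by
        gcongr with r
        have : ∀ t, Set.indicator {p : ℝ × ℝ | p.2 ≤ p.1}
          (fun p => ENNReal.ofReal (G' p.2)) (t, r)
            = (Set.Ici r).indicator (fun _ => ENNReal.ofReal (G' r)) t := by
          intro t
          by_cases h : r ≤ t <;> simp [h]
        simp_rw [this]
        rw [lintegral_indicator measurableSet_Ici, lintegral_const]
        rw [Measure.restrict_apply_univ]
        gcongr
        exact Measure.restrict_le_self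

/-- A differential inequality `G' ≤ t ^ β (δ G + E)` with `δ` small is integrated against a measure
with controlled tail. -/
theorem setLIntegral_le_of_deriv_le {β m s δ : ℝ} (hm : 0 < m) (hδ : 0 ≤ δ)
    (hδs : δ * s ≤ 1 / 2)
    {μ : Measure ℝ} [IsProbabilityMeasure μ]
    (h : ∀ x, m ≤ x → nuPlus β m μ (Set.Ici x) ≤ ENNReal.ofReal s * μ (Set.Ici x))
    {G G' E : ℝ → ℝ} (hG : ∀ t, HasDerivAt G (G' t) t) (hG' : Continuous G')
    (hG0 : ∀ t, m ≤ t → 0 ≤ G t) (hG'0 : ∀ t, m ≤ t → 0 ≤ G' t)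
    (hE : MonotoneOn E (Set.Ici m)) (hE0 : ∀ t, m ≤ t → 0 ≤ E t)
    (hle : ∀ t, m ≤ t → G' t ≤ t ^ β * (δ * G t + E t)) :
    ∫⁻ t in Set.Ici m, ENNReal.ofReal (G t) ∂μ
      ≤ 2 * (ENNReal.ofReal (G m) * μ (Set.Ici m)
        + ENNReal.ofReal s * ∫⁻ t in Set.Ici m, ENNReal.ofReal (E t) ∂μ) := by
  have hGm : MonotoneOn G (Set.Ici m) := by
    refine monotoneOn_of_deriv_nonneg (convex_Ici m)
      (fun x _ => (hG x).continuousAt.continuousWithinAt)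
      (fun x _ => (hG x).differentiableAt.differentiableWithinAt) ?_
    intro x hx
    rw [interior_Ici] at hx
    rw [(hG x).deriv]
    exact hG'0 x (le_of_lt hx)
  have hGc : Continuous G := continuous_iff_continuousAt.2 fun x => (hG x).continuousAt
  set J := ENNReal.ofReal (G m) * μ (Set.Ici m)
        + ENNReal.ofReal s * ∫⁻ t in Set.Ici m, ENNReal.ofReal (E t) ∂μ with hJ
  have trunc : ∀ R, m ≤ R → ∫⁻ t in Set.Ici m, ENNReal.ofReal (G (min t R)) ∂μ ≤ 2 * J := by
    intro R hR
    set I := ∫⁻ t in Set.Ici m, ENNReal.ofReal (G (min t R)) ∂μ with hI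
    have hmonR : MonotoneOn (fun t => G (min t R)) (Set.Ici m) := by
      intro x hx y hy hxy
      exact hGm (le_min hx hR) (le_min hy hR) (min_le_min_right R hxy)
    have h0R : ∀ t, m ≤ t → 0 ≤ G (min t R) := fun t ht => hG0 _ (le_min ht hR)
    -- Truncation at R is there for this finiteness: without it I ≤ J + I / 2 would say nothing.
    have hItop : I ≠ ⊤ := by
      have : I ≤ ∫⁻ t in Set.Ici m, ENNReal.ofReal (G R) ∂μ := by
        refine setLIntegral_mono' measurableSet_Ici fun t ht => ?_
        exact ENNReal.ofReal_le_ofReal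
          (hGm (le_min (Set.mem_Ici.1 ht) hR) (Set.mem_Ici.2 hR) (min_le_right t R))
      refine ne_top_of_le_ne_top ?_ this
      rw [lintegral_const]
      exact ENNReal.mul_ne_top ENNReal.ofReal_ne_top (measure_ne_top _ _)
    have h1 : I ≤ J + ENNReal.ofReal (1 / 2) * I := by
      calc I ≤ ENNReal.ofReal (G m) * μ (Set.Ici m)
            + ∫⁻ r in Set.Icc m R, ENNReal.ofReal (G' r) * μ (Set.Ici r) :=
            setLIntegral_min_le hR hG hG' hG'0
        _ ≤ ENNReal.ofReal (G m) * μ (Set.Ici m)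
            + ∫⁻ r in Set.Ici m, (ENNReal.ofReal δ * (ENNReal.ofReal (r ^ β) * μ (Set.Ici r) *
                ENNReal.ofReal (G (min r R)))
              + ENNReal.ofReal (r ^ β) * μ (Set.Ici r) * ENNReal.ofReal (E r)) := by
            refine add_le_add le_rfl ?_
            refine (setLIntegral_mono' measurableSet_Icc fun r hr => ?_).trans
              (lintegral_mono_set fun r (hr : r ∈ Set.Icc m R) => hr.1)
            have hr0 : 0 ≤ r ^ β := Real.rpow_nonneg (hm.le.trans hr.1) _
            rw [min_eq_left hr.2]
            calc ENNReal.ofReal (G' r) * μ (Set.Ici r)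
                ≤ ENNReal.ofReal (r ^ β * (δ * G r + E r)) * μ (Set.Ici r) := by
                  gcongr
                  exact hle r hr.1
              _ = _ := by
                  rw [ENNReal.ofReal_mul hr0, ENNReal.ofReal_add
                    (mul_nonneg hδ (hG0 r hr.1)) (hE0 r hr.1), ENNReal.ofReal_mul hδ]
                  ring
        _ = ENNReal.ofReal (G m) * μ (Set.Ici m)
            + (ENNReal.ofReal δ * (∫⁻ r in Set.Ici m, ENNReal.ofReal (r ^ β) * μ (Set.Ici r) *
                ENNReal.ofReal (G (min r R)))
              + ∫⁻ r in Set.Ici m,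
                  ENNReal.ofReal (r ^ β) * μ (Set.Ici r) * ENNReal.ofReal (E r)) := by
            have hmes := measurable_nuPlus_density β μ
            have hmes2 : Measurable fun r => G (min r R) := by fun_prop
            rw [lintegral_add_left (by fun_prop),
              lintegral_const_mul' _ _ ENNReal.ofReal_ne_top]
        _ ≤ ENNReal.ofReal (G m) * μ (Set.Ici m)
            + (ENNReal.ofReal δ * (ENNReal.ofReal s * I)
              + ENNReal.ofReal s * ∫⁻ t in Set.Ici m, ENNReal.ofReal (E t) ∂μ) := by
            gcongr
            · exact setLIntegral_tail_le h hmonR h0R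
            · exact setLIntegral_tail_le h hE hE0
        _ = J + ENNReal.ofReal (δ * s) * I := by
            rw [hJ, ENNReal.ofReal_mul hδ]
            ring
        _ ≤ J + ENNReal.ofReal (1 / 2) * I := by gcongr
    by_cases hJt : J = ⊤
    · simp [hJt]
    clear_value I J
    lift I to NNReal using hItop
    lift J to NNReal using hJt
    rw [show ENNReal.ofReal (1 / 2) = ((1 / 2 : NNReal) : ℝ≥0∞) by
      rw [ENNReal.ofReal, ENNReal.coe_inj]; ext; simp] at h1
    norm_cast at h1 ⊢
    rw [← NNReal.coe_le_coe] at h1 ⊢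
    push_cast at h1 ⊢
    linarith
  have hF : ∀ t, Filter.liminf (fun k : ℕ => ENNReal.ofReal (G (min t (m + k)))) Filter.atTop
      = ENNReal.ofReal (G t) := by
    intro t
    refine Filter.Tendsto.liminf_eq (tendsto_const_nhds.congr' ?_)
    filter_upwards [Filter.eventually_ge_atTop ⌈t - m⌉₊] with k hk
    have := Nat.ceil_le.1 hk
    rw [min_eq_left (by linarith)]
  calc ∫⁻ t in Set.Ici m, ENNReal.ofReal (G t) ∂μ
      = ∫⁻ t in Set.Ici m, Filter.liminf (fun k : ℕ => ENNReal.ofReal (G (min t (m + k))))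
          Filter.atTop ∂μ := by simp_rw [hF]
    _ ≤ Filter.liminf (fun k : ℕ => ∫⁻ t in Set.Ici m, ENNReal.ofReal (G (min t (m + k))) ∂μ)
          Filter.atTop := lintegral_liminf_le fun k => by fun_prop
    _ ≤ Filter.liminf (fun _ : ℕ => 2 * J) Filter.atTop := by
        refine Filter.liminf_le_liminf (Filter.Eventually.of_forall fun k => ?_)
        exact trunc _ (by simp)
    _ = 2 * J := by simp

/-- Enlarging the threshold preserves the tail condition. -/
theorem nuPlus_le_of_le {β m m' s : ℝ} (hmm : m ≤ m') {μ : Measure ℝ}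
    (h : ∀ x, m ≤ x → nuPlus β m μ (Set.Ici x) ≤ ENNReal.ofReal s * μ (Set.Ici x)) :
    ∀ x, m' ≤ x → nuPlus β m' μ (Set.Ici x) ≤ ENNReal.ofReal s * μ (Set.Ici x) := by
  intro x hx
  refine le_trans ?_ (h x (hmm.trans hx))
  rw [nuPlus, nuPlus, withDensity_apply _ measurableSet_Ici, withDensity_apply _ measurableSet_Ici]
  refine lintegral_mono' (Measure.restrict_mono le_rfl ?_) le_rfl
  exact Measure.restrict_mono (Set.Ici_subset_Ici.2 hmm) le_rfl

/-- Reflection exchanges the left and right tail conditions. -/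
theorem nuPlus_map_neg {β m x : ℝ} (hm : 0 ≤ m) (μ : Measure ℝ) :
    nuPlus β m (μ.map Neg.neg) (Set.Ici x) = nuMinus β m μ (Set.Iic (-x)) := by
  rw [nuPlus, nuMinus, withDensity_apply _ measurableSet_Ici, withDensity_apply _ measurableSet_Iic,
    Measure.restrict_restrict measurableSet_Ici, Measure.restrict_restrict measurableSet_Iic]
  have hp := (Measure.measurePreserving_neg (volume : Measure ℝ)).setLIntegral_comp_preimage_emb
    (MeasurableEquiv.neg ℝ).measurableEmbedding
    (fun t => ENNReal.ofReal (|t| ^ β) * μ (Set.Iic t)) (Set.Iic (-x) ∩ Set.Iic (-m))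
  rw [← hp]
  have hset : (Neg.neg ⁻¹' (Set.Iic (-x) ∩ Set.Iic (-m)) : Set ℝ) = Set.Ici x ∩ Set.Ici m := by
    ext t
    simp only [Set.mem_preimage, Set.mem_inter_iff, Set.mem_Iic, Set.mem_Ici, neg_le_neg_iff]
  rw [hset]
  refine setLIntegral_congr_fun (measurableSet_Ici.inter measurableSet_Ici) fun t ht => ?_
  have ht0 : 0 ≤ t := hm.trans ht.2
  have hset2 : (Neg.neg ⁻¹' Set.Ici t : Set ℝ) = Set.Iic (-t) := by
    ext y
    simp only [Set.mem_preimage, Set.mem_Ici, Set.mem_Iic]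
    constructor <;> intro h <;> linarith
  rw [abs_neg, abs_of_nonneg ht0, Measure.map_apply measurable_neg measurableSet_Ici, hset2]

/-- The second moment over the right tail is bounded in terms of the parameters. -/
theorem setLIntegral_sq_le {β m s : ℝ} (hβ : 0 ≤ β) (hm : 0 < m) (hs : 0 ≤ s)
    {μ : Measure ℝ} [IsProbabilityMeasure μ]
    (h : ∀ x, m ≤ x → nuPlus β m μ (Set.Ici x) ≤ ENNReal.ofReal s * μ (Set.Ici x)) :
    ∫⁻ t in Set.Ici m, ENNReal.ofReal (t ^ 2) ∂μ
      ≤ ENNReal.ofReal (2 * (m ^ 2 + s * (2 * (s + 1) / (m ^ β) ^ 2))) := by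
  have hmβ : 0 < m ^ β := Real.rpow_pos_of_pos hm β
  have hδ : (1 / (2 * (s + 1))) * s ≤ 1 / 2 := by
    rw [div_mul_eq_mul_div, div_le_div_iff₀ (by positivity) (by positivity)]
    linarith
  -- With a = m^β and b = 2(s + 1), completing the square gives 2t ≤ a (t² / b + b / a²), which
  -- fixes δ = 1 / b and the constant E.
  have key := setLIntegral_le_of_deriv_le (G := fun t => t ^ 2) (G' := fun t => 2 * t)
    (E := fun _ => 2 * (s + 1) / (m ^ β) ^ 2) hm (by positivity) hδ h
    (fun t => by simpa using hasDerivAt_pow 2 t) (by fun_prop) (fun t _ => sq_nonneg t)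
    (fun t ht => by linarith) (fun _ _ _ _ _ => le_rfl) (fun t _ => by positivity)
    (fun t ht => by
      have ht' : m ^ β ≤ t ^ β := Real.rpow_le_rpow hm.le ht hβ
      have h0 : 0 ≤ 1 / (2 * (s + 1)) * t ^ 2 + 2 * (s + 1) / (m ^ β) ^ 2 := by positivity
      refine le_trans ?_ (mul_le_mul_of_nonneg_right ht' h0)
      set a := m ^ β
      have hb : 0 < 2 * (s + 1) := by positivity
      set b := 2 * (s + 1)
      have : a * (1 / b * t ^ 2 + b / a ^ 2) - 2 * t = (a * t - b) ^ 2 / (a * b) := by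
        field_simp
        ring
      have h2 : 0 ≤ (a * t - b) ^ 2 / (a * b) := by positivity
      linarith)
  refine key.trans ?_
  have hμ : μ (Set.Ici m) ≤ 1 := prob_le_one
  rw [lintegral_const, Measure.restrict_apply_univ, ENNReal.ofReal_mul (by norm_num),
    ENNReal.ofReal_add (by positivity) (by positivity), ENNReal.ofReal_mul hs]
  rw [ENNReal.ofReal_ofNat]
  gcongr
  · exact mul_le_of_le_one_right' hμ
  · exact mul_le_of_le_one_right' hμ

/-! ### The Bregman divergence of exp and the pointwise inequalities -/

/-- The Bregman divergence of `exp`. -/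
noncomputable def bregman (c F : ℝ) : ℝ := Real.exp F * (F - c) - Real.exp F + Real.exp c

@[fun_prop]
theorem continuous_bregman (c : ℝ) : Continuous (bregman c) := by
  unfold bregman
  fun_prop

theorem bregman_self (c : ℝ) : bregman c c = 0 := by simp [bregman]

theorem hasDerivAt_bregman (c F : ℝ) : HasDerivAt (bregman c) (Real.exp F * (F - c)) F := by
  have h := (((Real.hasDerivAt_exp F).mul ((hasDerivAt_id F).sub_const c)).sub
    (Real.hasDerivAt_exp F)).add_const (Real.exp c)
  have e : Real.exp F * (id F - c) + Real.exp F * 1 - Real.exp F = Real.exp F * (F - c) := by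
    simp
  rw [e] at h
  exact h

theorem bregman_nonneg (c F : ℝ) : 0 ≤ bregman c F := by
  have h := Real.add_one_le_exp (c - F)
  have e : Real.exp c = Real.exp F * Real.exp (c - F) := by rw [← Real.exp_add]; ring_nf
  rw [bregman, e]
  nlinarith [mul_le_mul_of_nonneg_left h (Real.exp_pos F).le]

/-- Factoring out e^F leaves θ(w) = w - 1 + e^{-w}, so a differential inequality for the divergence
along f reduces to one between w and the slope of f. -/
theorem bregman_eq (c w : ℝ) :
    bregman c (c + w) = Real.exp (c + w) * (w - 1 + Real.exp (-w)) := by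
  have e : Real.exp c = Real.exp (c + w) * Real.exp (-w) := by rw [← Real.exp_add]; ring_nf
  rw [bregman, mul_add, ← e]
  ring

/-- Quadratic upper bound above the base point. -/
theorem bregman_le_of_le {c F : ℝ} (h : c ≤ F) : bregman c F ≤ Real.exp F * (F - c) ^ 2 := by
  obtain ⟨w, rfl⟩ : ∃ w, F = c + w := ⟨F - c, by ring⟩
  have hw : 0 ≤ w := by linarith
  rw [bregman_eq]
  gcongr
  have h1 : Real.exp (-w) ≤ 1 / (1 + w) := by
    rw [Real.exp_neg, ← one_div]
    gcongr
    linarith [Real.add_one_le_exp w]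
  have h2 : 1 / (1 + w) ≤ 1 - w + w ^ 2 := by
    rw [div_le_iff₀ (by positivity)]
    nlinarith [pow_nonneg hw 3]
  have : c + w - c = w := by ring
  rw [this]
  linarith

/-- Quadratic upper bound below the base point. -/
theorem bregman_le_of_ge {c F : ℝ} (h : F ≤ c) : bregman c F ≤ Real.exp c * (F - c) ^ 2 := by
  obtain ⟨v, rfl⟩ : ∃ v, F = c - v := ⟨c - F, by ring⟩
  have hv : 0 ≤ v := by linarith
  have e : Real.exp (c - v) = Real.exp c * Real.exp (-v) := by rw [← Real.exp_add]; ring_nf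
  have h1 : 1 - v ≤ Real.exp (-v) := by linarith [Real.add_one_le_exp (-v)]
  rw [bregman, e]
  have h2 : (1 - v) * (1 + v) ≤ Real.exp (-v) * (1 + v) := by gcongr
  nlinarith [mul_le_mul_of_nonneg_left h2 (Real.exp_pos c).le]

/-- Replace e^{-w} by its tangent at w = 1. The resulting line dominates w / 3 at w = 1 because
e^{-1} ≥ 1/3, and beyond because e^{-1} ≤ 2/3. -/
theorem linear_le_theta {w : ℝ} (hw : 1 ≤ w) : w / 3 ≤ w - 1 + Real.exp (-w) := by
  have h1 : Real.exp (-w) = Real.exp (-1) * Real.exp (1 - w) := by rw [← Real.exp_add]; ring_nf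
  have h2 := Real.add_one_le_exp (1 - w)
  have h3 : 1 / 3 ≤ Real.exp (-1) := by
    rw [Real.exp_neg, ← one_div]
    gcongr
    exact Real.exp_one_lt_three.le
  have h4 : Real.exp (-1) ≤ 2 / 3 := by
    have : Real.exp (-1) ≤ 1 / 2 := by
      rw [Real.exp_neg, ← one_div]
      gcongr
      linarith [Real.add_one_le_exp (1 : ℝ)]
    linarith
  rw [h1]
  nlinarith [mul_le_mul_of_nonneg_left h2 (Real.exp_pos (-1)).le]

/-- The Taylor remainder after w² / 2 is at most 2w³ / 9, and 1/2 - 2/9 exceeds 1/4. -/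
theorem sq_le_theta {w : ℝ} (h0 : 0 ≤ w) (hw : w ≤ 1) : w ^ 2 / 4 ≤ w - 1 + Real.exp (-w) := by
  have h := Real.exp_bound (x := -w) (by rw [abs_neg, abs_of_nonneg h0]; exact hw)
    (n := 3) (by norm_num)
  rw [abs_neg, abs_of_nonneg h0] at h
  have h' := (abs_le.1 h).1
  simp [Finset.sum_range_succ, Nat.factorial] at h'
  nlinarith [mul_le_mul_of_nonneg_left hw (sq_nonneg w)]

theorem theta_nonneg (w : ℝ) : 0 ≤ w - 1 + Real.exp (-w) := by
  linarith [Real.add_one_le_exp (-w)]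

/-- The pointwise inequality for bounded slopes, without weight. -/
theorem mul_le_theta_of_le {δ : ℝ} (hδ : 0 < δ) {w y : ℝ} (hw : 0 ≤ w)
    (hyδ : y ≤ δ / 3) : w * y ≤ δ * (w - 1 + Real.exp (-w)) + 1 / δ * y ^ 2 := by
  -- For w ≤ 1, θ is at least quadratic and a square completes. For w ≥ 1, θ ≥ w / 3 and the slope
  -- bound alone suffices.
  rcases le_total w 1 with h | h
  · have h1 := mul_le_mul_of_nonneg_left (sq_le_theta hw h) hδ.le
    have h2 : δ * (w ^ 2 / 4) + 1 / δ * y ^ 2 - w * y = (δ * w / 2 - y) ^ 2 / δ := by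
      field_simp
      ring
    have h3 : 0 ≤ (δ * w / 2 - y) ^ 2 / δ := by positivity
    linarith
  · have h1 := mul_le_mul_of_nonneg_left (linear_le_theta h) hδ.le
    have h2 := mul_le_mul_of_nonneg_left hyδ hw
    have h3 : 0 ≤ 1 / δ * y ^ 2 := by positivity
    linarith

/-- The pointwise inequality with the weight `t ^ β`, for arbitrary slopes. -/
theorem mul_le_theta_of_pos {β m δ : ℝ} (hβ : 0 < β) (hβ1 : β ≤ 1) (hm : 0 < m) (hδ : 0 < δ)
    {t w y : ℝ} (ht : m ≤ t) (hw : 0 ≤ w) (hy : 0 ≤ y) (hwy : w ≤ 2 * t * y) :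
    w * y ≤ t ^ β * (δ * (w - 1 + Real.exp (-w))
      + (1 / (δ * (m ^ β) ^ 2) + 2 * (3 / δ) ^ ((1 - β) / β))
        * max (y ^ 2) (y ^ ((β + 1) / β))) := by
  have ht0 : 0 < t := hm.trans_le ht
  have hmβ : 0 < m ^ β := Real.rpow_pos_of_pos hm β
  have htβ : 0 < t ^ β := Real.rpow_pos_of_pos ht0 β
  have hmt : m ^ β ≤ t ^ β := Real.rpow_le_rpow hm.le ht hβ.le
  have hK1 : 0 ≤ 1 / (δ * (m ^ β) ^ 2) := by positivity
  have hK2 : 0 ≤ 2 * (3 / δ) ^ ((1 - β) / β) := by positivity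
  have hd0 : 0 ≤ max (y ^ 2) (y ^ ((β + 1) / β)) := le_max_of_le_left (sq_nonneg y)
  -- Slopes below δ t^β / 3 fall under the unweighted inequality with δ t^β in place of δ. Otherwise
  -- t^β ≤ 3y / δ, so in w y ≤ 2 t y² = 2 t^β t^{1-β} y² the factor t^{1-β} is traded for a power of
  -- y; this produces the exponent (β + 1) / β.
  rcases le_or_gt y (δ * t ^ β / 3) with h | h
  · have h1 := mul_le_theta_of_le (mul_pos hδ htβ) hw h
    have h2 : 1 / (δ * t ^ β) * y ^ 2 ≤ t ^ β * (1 / (δ * (m ^ β) ^ 2) * y ^ 2) := by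
      rw [← mul_assoc]
      gcongr
      rw [mul_one_div, div_le_div_iff₀ (by positivity) (by positivity)]
      calc 1 * (δ * (m ^ β) ^ 2) ≤ 1 * (δ * (t ^ β) ^ 2) := by gcongr
        _ = _ := by ring
    have h3 : t ^ β * (1 / (δ * (m ^ β) ^ 2) * y ^ 2) ≤
        t ^ β * ((1 / (δ * (m ^ β) ^ 2) + 2 * (3 / δ) ^ ((1 - β) / β))
          * max (y ^ 2) (y ^ ((β + 1) / β))) := by
      gcongr
      · linarith
      · exact le_max_left _ _
    linarith
  · have hy0 : 0 < y := lt_of_le_of_lt (by positivity) h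
    have h1 : t ^ β ≤ 3 / δ * y := by
      rw [div_mul_eq_mul_div, le_div_iff₀ hδ]
      linarith
    have hexp : 0 ≤ (1 - β) / β := div_nonneg (by linarith) hβ.le
    have h2 : t ^ (1 - β) ≤ (3 / δ) ^ ((1 - β) / β) * y ^ ((1 - β) / β) := by
      rw [← Real.mul_rpow (by positivity) hy]
      calc t ^ (1 - β) = (t ^ β) ^ ((1 - β) / β) := by
            rw [← Real.rpow_mul ht0.le]
            congr 1
            field_simp
        _ ≤ _ := Real.rpow_le_rpow htβ.le h1 hexp
    have h3 : y ^ ((1 - β) / β) * y ^ 2 = y ^ ((β + 1) / β) := by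
      rw [← Real.rpow_natCast y 2, ← Real.rpow_add hy0]
      congr 1
      push_cast
      field_simp
      ring
    have h4 : t = t ^ β * t ^ (1 - β) := by
      rw [← Real.rpow_add ht0]
      simp
    have h5 : 0 ≤ δ * (w - 1 + Real.exp (-w)) := mul_nonneg hδ.le (theta_nonneg w)
    calc w * y ≤ 2 * t * y * y := by gcongr
      _ = t ^ β * (2 * t ^ (1 - β) * y ^ 2) := by
          conv_lhs => rw [h4]
          ring
      _ ≤ t ^ β * (2 * ((3 / δ) ^ ((1 - β) / β) * y ^ ((1 - β) / β)) * y ^ 2) := by gcongr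
      _ = t ^ β * (2 * (3 / δ) ^ ((1 - β) / β) * y ^ ((β + 1) / β)) := by rw [← h3]; ring
      _ ≤ _ := by
          gcongr
          calc 2 * (3 / δ) ^ ((1 - β) / β) * y ^ ((β + 1) / β)
              ≤ (1 / (δ * (m ^ β) ^ 2) + 2 * (3 / δ) ^ ((1 - β) / β))
                * max (y ^ 2) (y ^ ((β + 1) / β)) := by
                gcongr
                · linarith
                · exact le_max_right _ _
            _ ≤ _ := by linarith

/-- The kink of max at c does no harm, since B_c has zero derivative there. -/
theorem hasDerivAt_bregman_max (c F : ℝ) :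
    HasDerivAt (fun F => bregman c (max F c)) (Real.exp (max F c) * (max F c - c)) F := by
  rcases lt_trichotomy F c with h | rfl | h
  · have e : (fun F => bregman c (max F c)) =ᶠ[nhds F] fun _ => 0 := by
      filter_upwards [gt_mem_nhds h] with x hx
      rw [max_eq_right hx.le, bregman_self]
    rw [max_eq_right h.le, sub_self, mul_zero]
    exact (hasDerivAt_const F (0 : ℝ)).congr_of_eventuallyEq e
  · rw [max_self, sub_self, mul_zero, ← hasDerivWithinAt_univ, ← Set.Iic_union_Ici (a := F)]
    refine HasDerivWithinAt.union ?_ ?_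
    · refine (hasDerivWithinAt_const F _ (0 : ℝ)).congr (fun x hx => ?_) ?_
      · rw [max_eq_right (Set.mem_Iic.1 hx), bregman_self]
      · rw [max_self, bregman_self]
    · have h := (hasDerivAt_bregman F F).hasDerivWithinAt (s := Set.Ici F)
      rw [sub_self, mul_zero] at h
      refine h.congr (fun x hx => ?_) ?_
      · rw [max_eq_left (Set.mem_Ici.1 hx)]
      · rw [max_self]
  · have e : (fun F => bregman c (max F c)) =ᶠ[nhds F] bregman c := by
      filter_upwards [lt_mem_nhds h] with x hx
      rw [max_eq_left hx.le]
    rw [max_eq_left h.le]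
    exact (hasDerivAt_bregman c F).congr_of_eventuallyEq e

/-! ### The one-dimensional inequality -/

/-- A differentiable function with nondecreasing derivative lies above its tangents. -/
theorem tangent_le {f f' : ℝ → ℝ} (hf : ∀ t, HasDerivAt f (f' t) t) (hmono : Monotone f')
    (x y : ℝ) : f y + f' y * (x - y) ≤ f x := by
  have hc : ∀ s : Set ℝ, ContinuousOn f s := fun s x _ => (hf x).continuousAt.continuousWithinAt
  rcases lt_trichotomy x y with h | rfl | h
  · obtain ⟨z, hz, e⟩ := exists_hasDerivAt_eq_slope f f' h (hc _) (fun t _ => hf t)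
    have h1 := hmono hz.2.le
    rw [e, div_le_iff₀ (by linarith)] at h1
    linarith
  · simp
  · obtain ⟨z, hz, e⟩ := exists_hasDerivAt_eq_slope f f' h (hc _) (fun t _ => hf t)
    have h1 := hmono hz.1.le
    rw [e, le_div_iff₀ (by linarith)] at h1
    linarith

/-- One-sided entropy estimate on the right tail. -/
theorem setLIntegral_bregman_max_le {β m s δ K : ℝ} (hm : 0 < m) (hs : 0 ≤ s) (hδ : 0 ≤ δ)
    (hδs : δ * s ≤ 1 / 2) (hK : 0 ≤ K)
    {μ : Measure ℝ} [IsProbabilityMeasure μ]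
    (h : ∀ x, m ≤ x → nuPlus β m μ (Set.Ici x) ≤ ENNReal.ofReal s * μ (Set.Ici x))
    {f f' d : ℝ → ℝ} (hf : ∀ t, HasDerivAt f (f' t) t) (hf' : Continuous f') (hmono : Monotone f')
    (hd : MonotoneOn d (Set.Ici 0)) (hdsq : ∀ y, 0 ≤ y → y ^ 2 ≤ d y)
    {y₀ : ℝ} (hy₀ : y₀ ∈ Set.Icc (-m) m)
    (hP : ∀ t, m ≤ t → ∀ w, 0 ≤ w → 0 ≤ f' t → w ≤ 2 * t * f' t →
      w * f' t ≤ t ^ β * (δ * (w - 1 + Real.exp (-w)) + K * d (f' t))) :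
    ∫⁻ t in Set.Ici m, ENNReal.ofReal (bregman (f y₀) (max (f t) (f y₀))) ∂μ
      ≤ ENNReal.ofReal (2 * (4 * m ^ 2 + s * K))
        * ∫⁻ t in Set.Ici m, ENNReal.ofReal (Real.exp (f t) * d |f' t|) ∂μ := by
  set c := f y₀ with hc
  have hfc : Continuous f := continuous_iff_continuousAt.2 fun x => (hf x).continuousAt
  have hd0 : ∀ y, 0 ≤ y → 0 ≤ d y := fun y hy => (sq_nonneg y).trans (hdsq y hy)
  have htan : ∀ t, f t - c ≤ f' t * (t - y₀) := fun t => by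
    have := tangent_le hf hmono y₀ t
    linarith
  have hpos : ∀ t, m ≤ t → c < f t → 0 ≤ f' t := fun t ht hct => by
    by_contra hneg
    have h1 := htan t
    have h2 : f' t * (t - y₀) ≤ 0 :=
      mul_nonpos_of_nonpos_of_nonneg (not_le.1 hneg).le (by linarith [hy₀.2])
    linarith
  have hw : ∀ t, m ≤ t → c < f t → f t - c ≤ 2 * t * f' t := fun t ht hct => by
    have h1 := htan t
    have h2 := mul_le_mul_of_nonneg_left (show t - y₀ ≤ 2 * t by linarith [hy₀.1]) (hpos t ht hct)
    linarith
  -- Cutting off at f ≤ c makes D nondecreasing: beyond m, f > c forces f' ≥ 0, and from there on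
  -- both f and f' increase.
  let D : ℝ → ℝ := fun t => if c < f t then Real.exp (f t) * d (f' t) else 0
  have hD0 : ∀ t, m ≤ t → 0 ≤ D t := fun t ht => by
    simp only [D]
    split_ifs with hct
    · exact mul_nonneg (Real.exp_pos _).le (hd0 _ (hpos t ht hct))
    · exact le_rfl
  have hDmono : MonotoneOn D (Set.Ici m) := fun x hx y hy hxy => by
    by_cases hcx : c < f x
    · have h1 := hpos x hx hcx
      have h2 : f x ≤ f y := by
        have := tangent_le hf hmono y x
        have h3 := mul_nonneg h1 (sub_nonneg.2 hxy)
        linarith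
      have h4 := hmono hxy
      simp only [D, if_pos hcx, if_pos (hcx.trans_le h2)]
      exact mul_le_mul (Real.exp_le_exp.2 h2) (hd h1 (h1.trans h4) h4) (hd0 _ h1)
        (Real.exp_pos _).le
    · simp only [D, if_neg hcx]
      exact hD0 y hy
  have hDle : ∀ t, m ≤ t → D t ≤ Real.exp (f t) * d |f' t| := fun t ht => by
    simp only [D]
    split_ifs with hct
    · rw [abs_of_nonneg (hpos t ht hct)]
    · exact mul_nonneg (Real.exp_pos _).le (hd0 _ (abs_nonneg _))
  have key := setLIntegral_le_of_deriv_le (G := fun t => bregman c (max (f t) c))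
    (G' := fun t => Real.exp (max (f t) c) * (max (f t) c - c) * f' t)
    (E := fun t => K * D t) hm hδ hδs h
    (fun t => (hasDerivAt_bregman_max c (f t)).comp t (hf t)) (by fun_prop)
    (fun t _ => bregman_nonneg _ _)
    (fun t ht => by
      rcases le_or_gt (f t) c with hct | hct
      · simp [max_eq_right hct]
      · have := hpos t ht hct
        have h2 : 0 ≤ max (f t) c - c := sub_nonneg.2 (le_max_right _ _)
        positivity)
    (fun x hx y hy hxy => mul_le_mul_of_nonneg_left (hDmono hx hy hxy) hK)
    (fun t ht => mul_nonneg hK (hD0 t ht))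
    (fun t ht => by
      have ht0 : 0 ≤ t ^ β := Real.rpow_nonneg (hm.le.trans ht) _
      rcases le_or_gt (f t) c with hct | hct
      · rw [max_eq_right hct, sub_self, mul_zero, zero_mul]
        exact mul_nonneg ht0 (add_nonneg (mul_nonneg hδ (bregman_nonneg _ _))
          (mul_nonneg hK (hD0 t ht)))
      · rw [max_eq_left hct.le]
        have h1 := hP t ht (f t - c) (sub_nonneg.2 hct.le) (hpos t ht hct) (hw t ht hct)
        have h2 := bregman_eq c (f t - c)
        rw [add_sub_cancel] at h2
        simp only [D, if_pos hct]
        rw [h2]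
        calc Real.exp (f t) * (f t - c) * f' t = Real.exp (f t) * ((f t - c) * f' t) := by ring
          _ ≤ Real.exp (f t) * (t ^ β * (δ * (f t - c - 1 + Real.exp (-(f t - c)))
              + K * d (f' t))) := by gcongr
          _ = _ := by ring)
  refine key.trans ?_
  -- The boundary term is quadratic in f(m) - c ≤ 2 m f'(m). Monotonicity of D then turns D(m) μ[m,
  -- ∞) into at most ∫ D.
  have hGm : bregman c (max (f m) c) ≤ 4 * m ^ 2 * D m := by
    rcases le_or_gt (f m) c with hct | hct
    · rw [max_eq_right hct, bregman_self]
      exact mul_nonneg (by positivity) (hD0 m le_rfl)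
    · rw [max_eq_left hct.le]
      have h1 := hw m le_rfl hct
      have h2 := hpos m le_rfl hct
      have h3 : 0 ≤ f m - c := sub_nonneg.2 hct.le
      simp only [D, if_pos hct]
      calc bregman c (f m) ≤ Real.exp (f m) * (f m - c) ^ 2 := bregman_le_of_le hct.le
        _ ≤ Real.exp (f m) * (2 * m * f' m) ^ 2 := by gcongr
        _ = 4 * m ^ 2 * (Real.exp (f m) * (f' m) ^ 2) := by ring
        _ ≤ _ := by
          gcongr
          exact hdsq _ h2
  have hfirst : ENNReal.ofReal (bregman c (max (f m) c)) * μ (Set.Ici m)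
      ≤ ENNReal.ofReal (4 * m ^ 2) * ∫⁻ t in Set.Ici m, ENNReal.ofReal (D t) ∂μ := by
    rw [← lintegral_const_mul' _ _ ENNReal.ofReal_ne_top, ← setLIntegral_const]
    refine setLIntegral_mono' measurableSet_Ici fun t ht => ?_
    rw [← ENNReal.ofReal_mul (by positivity)]
    refine ENNReal.ofReal_le_ofReal (hGm.trans ?_)
    gcongr
    exact hDmono Set.self_mem_Ici ht ht
  have hsecond : ∫⁻ t in Set.Ici m, ENNReal.ofReal (K * D t) ∂μ
      = ENNReal.ofReal K * ∫⁻ t in Set.Ici m, ENNReal.ofReal (D t) ∂μ := by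
    simp_rw [ENNReal.ofReal_mul hK]
    rw [lintegral_const_mul' _ _ ENNReal.ofReal_ne_top]
  calc 2 * (ENNReal.ofReal (bregman c (max (f m) c)) * μ (Set.Ici m)
        + ENNReal.ofReal s * ∫⁻ t in Set.Ici m, ENNReal.ofReal (K * D t) ∂μ)
      ≤ 2 * (ENNReal.ofReal (4 * m ^ 2) * ∫⁻ t in Set.Ici m, ENNReal.ofReal (D t) ∂μ
        + ENNReal.ofReal s * (ENNReal.ofReal K *
          ∫⁻ t in Set.Ici m, ENNReal.ofReal (D t) ∂μ)) := by
        rw [hsecond]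
        gcongr
    _ = ENNReal.ofReal (2 * (4 * m ^ 2 + s * K))
          * ∫⁻ t in Set.Ici m, ENNReal.ofReal (D t) ∂μ := by
        rw [ENNReal.ofReal_mul (p := 2) (by norm_num),
          ENNReal.ofReal_add (by positivity) (by positivity), ENNReal.ofReal_mul hs,
          ENNReal.ofReal_ofNat]
        ring
    _ ≤ _ := mul_le_mul_right (setLIntegral_mono' measurableSet_Ici fun t ht =>
          ENNReal.ofReal_le_ofReal (hDle t ht)) _

/-- A point of `[-m, m]` minimising a convex function there, with its first order condition. -/
theorem exists_first_order {m : ℝ} (hm : 0 < m) {f' : ℝ → ℝ} (hf' : Continuous f') :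
    ∃ y₀ ∈ Set.Icc (-m) m, ∀ x ∈ Set.Icc (-m) m, 0 ≤ f' y₀ * (x - y₀) := by
  rcases le_or_gt 0 (f' (-m)) with h1 | h1
  · exact ⟨-m, ⟨le_rfl, by linarith⟩, fun x hx => mul_nonneg h1 (by linarith [hx.1])⟩
  rcases le_or_gt (f' m) 0 with h2 | h2
  · exact ⟨m, ⟨by linarith, le_rfl⟩, fun x hx => mul_nonneg_of_nonpos_of_nonpos h2
      (by linarith [hx.2])⟩
  obtain ⟨y, hy, e⟩ := intermediate_value_Icc (show -m ≤ m by linarith) hf'.continuousOn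
    (show (0 : ℝ) ∈ Set.Icc (f' (-m)) (f' m) from ⟨h1.le, h2.le⟩)
  exact ⟨y, hy, fun x _ => by simp [e]⟩

/-- One of the two terms on the right is B_c(c) = 0; the excursions above and below c can thus be
estimated separately. -/
theorem bregman_le_max_add_min (c F : ℝ) :
    bregman c F ≤ bregman c (max F c) + bregman c (min F c) := by
  rcases le_total F c with h | h
  · rw [min_eq_left h]
    linarith [bregman_nonneg c (max F c)]
  · rw [max_eq_left h]
    linarith [bregman_nonneg c (min F c)]

theorem setLIntegral_Ici_map_neg (μ : Measure ℝ) (m : ℝ) (g : ℝ → ℝ≥0∞) :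
    ∫⁻ t in Set.Ici m, g (-t) ∂(μ.map Neg.neg) = ∫⁻ t in Set.Iic (-m), g t ∂μ := by
  have he : MeasurableEmbedding (Neg.neg : ℝ → ℝ) := (MeasurableEquiv.neg ℝ).measurableEmbedding
  rw [he.restrict_map, he.lintegral_map]
  have hset : (Neg.neg ⁻¹' Set.Ici m : Set ℝ) = Set.Iic (-m) := by
    ext y
    simp only [Set.mem_preimage, Set.mem_Ici, Set.mem_Iic]
    constructor <;> intro h <;> linarith
  simp_rw [hset, neg_neg]

/-- The one-dimensional modified logarithmic Sobolev inequality for convex functions, in terms of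
the tails, the second moment and the mass of `[-m, m]`. -/
theorem exists_lintegral_bregman_le {β m s δ K V : ℝ} (hm : 0 < m) (hs : 0 ≤ s) (hδ : 0 ≤ δ)
    (hδs : δ * s ≤ 1 / 2) (hK : 0 ≤ K) (hV : 0 ≤ V)
    {μ : Measure ℝ} [IsProbabilityMeasure μ]
    (hR : ∀ x, m ≤ x → nuPlus β m μ (Set.Ici x) ≤ ENNReal.ofReal s * μ (Set.Ici x))
    (hL : ∀ x, m ≤ x → nuPlus β m (μ.map Neg.neg) (Set.Ici x)
      ≤ ENNReal.ofReal s * μ.map Neg.neg (Set.Ici x))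
    (hvar : ∫⁻ t, ENNReal.ofReal (t ^ 2) ∂μ ≤ ENNReal.ofReal V)
    (hmass : 1 / 2 ≤ μ (Set.Icc (-m) m))
    {f f' d : ℝ → ℝ} (hf : ∀ t, HasDerivAt f (f' t) t) (hf' : Continuous f') (hmono : Monotone f')
    (hd : MonotoneOn d (Set.Ici 0)) (hdsq : ∀ y, 0 ≤ y → y ^ 2 ≤ d y)
    (hP : ∀ x t, m ≤ t → ∀ w, 0 ≤ w → w ≤ 2 * t * |f' x| →
      w * |f' x| ≤ t ^ β * (δ * (w - 1 + Real.exp (-w)) + K * d |f' x|)) :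
    ∃ c, ∫⁻ t, ENNReal.ofReal (bregman c (f t)) ∂μ
      ≤ ENNReal.ofReal (4 * (4 * m ^ 2 + s * K) + 4 * m ^ 2 + 4 * (V + m ^ 2))
        * ∫⁻ t, ENNReal.ofReal (Real.exp (f t) * d |f' t|) ∂μ := by
  obtain ⟨y₀, hy₀, hfo⟩ := exists_first_order hm hf'
  have hfc : Continuous f := continuous_iff_continuousAt.2 fun x => (hf x).continuousAt
  refine ⟨f y₀, ?_⟩
  set c := f y₀ with hc
  set T := ∫⁻ t, ENNReal.ofReal (Real.exp (f t) * d |f' t|) ∂μ with hT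
  have hTle : ∀ S : Set ℝ, ∫⁻ t in S, ENNReal.ofReal (Real.exp (f t) * d |f' t|) ∂μ ≤ T :=
    fun S => setLIntegral_le_lintegral _ _
  have right : ∫⁻ t in Set.Ici m, ENNReal.ofReal (bregman c (max (f t) c)) ∂μ
      ≤ ENNReal.ofReal (2 * (4 * m ^ 2 + s * K)) * T := by
    refine (setLIntegral_bregman_max_le hm hs hδ hδs hK hR hf hf' hmono hd hdsq hy₀
      fun t ht w hw0 hf0 hw => ?_).trans (by gcongr; exact hTle _)
    have := hP t t ht w hw0
    rw [abs_of_nonneg hf0] at this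
    exact this hw
  have left : ∫⁻ t in Set.Iic (-m), ENNReal.ofReal (bregman c (max (f t) c)) ∂μ
      ≤ ENNReal.ofReal (2 * (4 * m ^ 2 + s * K)) * T := by
    have : IsProbabilityMeasure (μ.map Neg.neg) :=
      Measure.isProbabilityMeasure_map measurable_neg.aemeasurable
    have key := setLIntegral_bregman_max_le (f := fun t => f (-t)) (f' := fun t => -f' (-t))
      (y₀ := -y₀) hm hs hδ hδs hK hL
      (fun t => by
        have := (hf (-t)).comp t (hasDerivAt_neg t)
        rwa [mul_neg_one] at this)
      (by fun_prop) (fun x y hxy => neg_le_neg (hmono (neg_le_neg hxy))) hd hdsq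
      ⟨by linarith [hy₀.2], by linarith [hy₀.1]⟩
      (fun t ht w hw0 hf0 hw => by
        -- The slope is taken at -t and the weight at t, which is why `hP` has two independent
        -- points.
        have := hP (-t) t ht w hw0
        rw [← abs_neg, abs_of_nonneg hf0] at this
        exact this hw)
    simp only [neg_neg, abs_neg] at key
    rw [setLIntegral_Ici_map_neg μ m (fun t => ENNReal.ofReal (bregman (f y₀) (max (f t) (f y₀)))),
      setLIntegral_Ici_map_neg μ m (fun t => ENNReal.ofReal (Real.exp (f t) * d |f' t|))] at key
    exact key.trans (by gcongr; exact hTle _)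
  have hmin : ∀ x ∈ Set.Icc (-m) m, c ≤ f x := fun x hx => by
    have := tangent_le hf hmono x y₀
    linarith [hfo x hx]
  have middle : ∫⁻ t in Set.Icc (-m) m, ENNReal.ofReal (bregman c (max (f t) c)) ∂μ
      ≤ ENNReal.ofReal (4 * m ^ 2) * T := by
    refine le_trans ?_ (mul_le_mul_right (hTle (Set.Icc (-m) m)) _)
    rw [← lintegral_const_mul' _ _ ENNReal.ofReal_ne_top]
    refine setLIntegral_mono' measurableSet_Icc fun t ht => ?_
    rw [← ENNReal.ofReal_mul (by positivity)]
    refine ENNReal.ofReal_le_ofReal ?_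
    have h0 := hmin t ht
    have h1 := tangent_le hf hmono y₀ t
    have h2 : |t - y₀| ≤ 2 * m := by
      rw [abs_le]
      constructor <;> linarith [hy₀.1, hy₀.2, ht.1, ht.2]
    have h3 : f t - c ≤ |f' t| * (2 * m) := by
      calc f t - c ≤ f' t * (t - y₀) := by linarith
        _ ≤ |f' t * (t - y₀)| := le_abs_self _
        _ = |f' t| * |t - y₀| := abs_mul _ _
        _ ≤ _ := by gcongr
    have h4 : 0 ≤ f t - c := by linarith
    rw [max_eq_left h0]
    calc bregman c (f t) ≤ Real.exp (f t) * (f t - c) ^ 2 := bregman_le_of_le h0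
      _ ≤ Real.exp (f t) * (|f' t| * (2 * m)) ^ 2 := by gcongr
      _ = 4 * m ^ 2 * (Real.exp (f t) * |f' t| ^ 2) := by ring
      _ ≤ _ := by
        gcongr
        exact hdsq _ (abs_nonneg _)
  have below : ∫⁻ t, ENNReal.ofReal (bregman c (min (f t) c)) ∂μ
      ≤ ENNReal.ofReal (4 * (V + m ^ 2)) * T := by
    set A := ENNReal.ofReal (Real.exp c * f' y₀ ^ 2) with hA
    have h1 : ∫⁻ t, ENNReal.ofReal (bregman c (min (f t) c)) ∂μ
        ≤ A * ENNReal.ofReal (2 * (V + m ^ 2)) := by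
      calc ∫⁻ t, ENNReal.ofReal (bregman c (min (f t) c)) ∂μ
          ≤ ∫⁻ t, A * (ENNReal.ofReal 2 *
              (ENNReal.ofReal (t ^ 2) + ENNReal.ofReal (m ^ 2))) ∂μ := by
            refine lintegral_mono fun t => ?_
            rw [← ENNReal.ofReal_add (by positivity) (by positivity),
              ← ENNReal.ofReal_mul (by norm_num), hA, ← ENNReal.ofReal_mul (by positivity)]
            refine ENNReal.ofReal_le_ofReal ?_
            rcases le_total c (f t) with h | h
            · rw [min_eq_right h, bregman_self]
              positivity
            · rw [min_eq_left h]
              have h2 := tangent_le hf hmono t y₀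
              -- The tangent at y₀ lies below f, and f ≤ c here, so 0 ≥ f(t) - c ≥ f'(y₀)(t - y₀).
              have h3 : (f t - c) ^ 2 ≤ (f' y₀ * (t - y₀)) ^ 2 :=
                (by nlinarith)
              have h4 : (t - y₀) ^ 2 ≤ 2 * (t ^ 2 + m ^ 2) := by
                have : y₀ ^ 2 ≤ m ^ 2 := sq_le_sq' hy₀.1 hy₀.2
                nlinarith [sq_nonneg (t + y₀)]
              calc bregman c (f t) ≤ Real.exp c * (f t - c) ^ 2 := bregman_le_of_ge h
                _ ≤ Real.exp c * (f' y₀ * (t - y₀)) ^ 2 := by gcongr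
                _ = Real.exp c * f' y₀ ^ 2 * (t - y₀) ^ 2 := by ring
                _ ≤ _ := by gcongr
        _ = A * (ENNReal.ofReal 2 * (∫⁻ t, ENNReal.ofReal (t ^ 2) ∂μ
              + ENNReal.ofReal (m ^ 2))) := by
            rw [lintegral_const_mul' _ _ ENNReal.ofReal_ne_top,
              lintegral_const_mul' _ _ ENNReal.ofReal_ne_top, lintegral_add_right _ measurable_const,
              lintegral_const, measure_univ, mul_one]
        _ ≤ A * (ENNReal.ofReal 2 * (ENNReal.ofReal V + ENNReal.ofReal (m ^ 2))) := by gcongr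
        _ = _ := by
            rw [← ENNReal.ofReal_add hV (by positivity), ← ENNReal.ofReal_mul (by norm_num)]
    -- On [-m, m], f ≥ c, and the first order condition with monotone f' gives |f'| ≥ |f'(y₀)|. The
    -- mass bound then recovers A from T.
    have h2 : A * (1 / 2) ≤ T := by
      calc A * (1 / 2) ≤ A * μ (Set.Icc (-m) m) := by gcongr
        _ = ∫⁻ _ in Set.Icc (-m) m, A ∂μ := (setLIntegral_const _ _).symm
        _ ≤ ∫⁻ t in Set.Icc (-m) m, ENNReal.ofReal (Real.exp (f t) * d |f' t|) ∂μ := by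
            refine setLIntegral_mono' measurableSet_Icc fun t ht => ?_
            refine ENNReal.ofReal_le_ofReal ?_
            have h3 := hfo t ht
            have h4 : |f' y₀| ≤ |f' t| := by
              rcases lt_trichotomy (f' y₀) 0 with hn | hn | hn
              · have h5 : t - y₀ ≤ 0 := nonpos_of_mul_nonneg_right h3 hn
                have h6 := hmono (show t ≤ y₀ by linarith)
                rw [abs_of_neg hn, abs_of_neg (by linarith)]
                linarith
              · simp [hn]
              · have h5 : 0 ≤ t - y₀ := nonneg_of_mul_nonneg_right h3 hn
                have h6 := hmono (show y₀ ≤ t by linarith)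
                rw [abs_of_pos hn, abs_of_pos (by linarith)]
                linarith
            calc Real.exp c * f' y₀ ^ 2 = Real.exp c * |f' y₀| ^ 2 := by rw [sq_abs]
              _ ≤ Real.exp (f t) * |f' t| ^ 2 := by
                gcongr
                exact hmin t ht
              _ ≤ _ := by
                gcongr
                exact hdsq _ (abs_nonneg _)
        _ ≤ T := hTle _
    calc _ ≤ A * ENNReal.ofReal (2 * (V + m ^ 2)) := h1
      _ = ENNReal.ofReal (4 * (V + m ^ 2)) * (A * (1 / 2)) := by
          have : 4 * (V + m ^ 2) = 2 * (2 * (V + m ^ 2)) := by ring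
          rw [this, ENNReal.ofReal_mul (by norm_num) (q := 2 * (V + m ^ 2)), ENNReal.ofReal_ofNat]
          rw [show ∀ a : ℝ≥0∞, 2 * a * (A * (1 / 2)) = (2 * (1 / 2)) * (A * a) by intro a; ring,
            one_div, ENNReal.mul_inv_cancel two_ne_zero ENNReal.ofNat_ne_top, one_mul]
      _ ≤ _ := by gcongr
  have above : ∫⁻ t, ENNReal.ofReal (bregman c (max (f t) c)) ∂μ
      ≤ ENNReal.ofReal (2 * (4 * m ^ 2 + s * K)) * T + ENNReal.ofReal (4 * m ^ 2) * T
        + ENNReal.ofReal (2 * (4 * m ^ 2 + s * K)) * T := by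
    have hun : (Set.univ : Set ℝ) = Set.Iic (-m) ∪ Set.Icc (-m) m ∪ Set.Ici m := by
      ext t
      simp only [Set.mem_univ, Set.mem_union, Set.mem_Iic, Set.mem_Icc, Set.mem_Ici, true_iff]
      by_cases h1 : t ≤ -m
      · exact Or.inl (Or.inl h1)
      · by_cases h2 : m ≤ t
        · exact Or.inr h2
        · exact Or.inl (Or.inr ⟨by linarith, by linarith⟩)
    rw [← setLIntegral_univ, hun]
    refine (lintegral_union_le _ _ _).trans ?_
    refine add_le_add ((lintegral_union_le _ _ _).trans (add_le_add left middle)) right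
  have hmeas : Measurable fun t => ENNReal.ofReal (bregman c (max (f t) c)) := by fun_prop
  calc ∫⁻ t, ENNReal.ofReal (bregman c (f t)) ∂μ
      ≤ ∫⁻ t, (ENNReal.ofReal (bregman c (max (f t) c))
          + ENNReal.ofReal (bregman c (min (f t) c))) ∂μ := by
        refine lintegral_mono fun t => ?_
        rw [← ENNReal.ofReal_add (bregman_nonneg _ _) (bregman_nonneg _ _)]
        exact ENNReal.ofReal_le_ofReal (bregman_le_max_add_min _ _)
    _ = ∫⁻ t, ENNReal.ofReal (bregman c (max (f t) c)) ∂μ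
          + ∫⁻ t, ENNReal.ofReal (bregman c (min (f t) c)) ∂μ := lintegral_add_left hmeas _
    _ ≤ (ENNReal.ofReal (2 * (4 * m ^ 2 + s * K)) * T + ENNReal.ofReal (4 * m ^ 2) * T
        + ENNReal.ofReal (2 * (4 * m ^ 2 + s * K)) * T) + ENNReal.ofReal (4 * (V + m ^ 2)) * T :=
        add_le_add above below
    _ = _ := by
        have h1 : 0 ≤ 2 * (4 * m ^ 2 + s * K) := by positivity
        have h2 : 0 ≤ 4 * m ^ 2 := by positivity
        have h3 : 0 ≤ 4 * (V + m ^ 2) := by positivity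
        rw [← add_mul, ← add_mul, ← add_mul, ← ENNReal.ofReal_add h1 h2,
          ← ENNReal.ofReal_add (by positivity) h1, ← ENNReal.ofReal_add (by positivity) h3]
        congr 2
        ring

/-! ### Truncation and coercivity of the divergence; comparison with entropy -/

theorem bregman_three_points (c G F : ℝ) :
    bregman c F = bregman c G + bregman G F + (Real.exp F - Real.exp G) * (G - c) := by
  unfold bregman
  ring

/-- For G between c and F the cross term of the three-point identity is nonnegative, so each
remaining divergence is dominated by the whole. -/
theorem bregman_le_of_between {c G F : ℝ} (h : c ≤ G ∧ G ≤ F ∨ F ≤ G ∧ G ≤ c) :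
    bregman c G ≤ bregman c F ∧ bregman G F ≤ bregman c F := by
  have h1 : 0 ≤ (Real.exp F - Real.exp G) * (G - c) := by
    rcases h with ⟨h1, h2⟩ | ⟨h1, h2⟩
    · exact mul_nonneg (sub_nonneg.2 (Real.exp_le_exp.2 h2)) (sub_nonneg.2 h1)
    · exact mul_nonneg_of_nonpos_of_nonpos (sub_nonpos.2 (Real.exp_le_exp.2 h1))
        (sub_nonpos.2 h2)
  have h2 := bregman_three_points c G F
  constructor <;> linarith [bregman_nonneg c G, bregman_nonneg G F]

theorem bregman_min_le (k c F : ℝ) : bregman (min c k) (min F k) ≤ bregman c F := by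
  rcases le_total c k with h1 | h1 <;> rcases le_total F k with h2 | h2
  · rw [min_eq_left h1, min_eq_left h2]
  · rw [min_eq_left h1, min_eq_right h2]
    exact (bregman_le_of_between (Or.inl ⟨h1, h2⟩)).1
  · rw [min_eq_right h1, min_eq_left h2]
    exact (bregman_le_of_between (Or.inr ⟨h2, h1⟩)).2
  · rw [min_eq_right h1, min_eq_right h2, bregman_self]
    exact bregman_nonneg _ _

theorem bregman_max_le (k c F : ℝ) : bregman (max c k) (max F k) ≤ bregman c F := by
  rcases le_total c k with h1 | h1 <;> rcases le_total F k with h2 | h2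
  · rw [max_eq_right h1, max_eq_right h2, bregman_self]
    exact bregman_nonneg _ _
  · rw [max_eq_right h1, max_eq_left h2]
    exact (bregman_le_of_between (Or.inl ⟨h1, h2⟩)).2
  · rw [max_eq_left h1, max_eq_right h2]
    exact (bregman_le_of_between (Or.inr ⟨h2, h1⟩)).1
  · rw [max_eq_left h1, max_eq_left h2]

/-- Coercivity in the base point: for fixed F the divergence tends to infinity as |c| → ∞. This
rules out escaping base points in the limit of truncations. -/
theorem exp_mul_abs_sub_le_bregman (c F : ℝ) :
    Real.exp F * (|c - F| - 1) ≤ bregman c F := by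
  have hF := Real.exp_pos F
  rcases le_total c F with h | h
  · rw [abs_of_nonpos (by linarith), bregman]
    nlinarith [Real.exp_pos c]
  · rw [abs_of_nonneg (by linarith), bregman]
    have h1 : Real.exp c = Real.exp F * (Real.exp 1 * Real.exp (c - F - 1)) := by
      rw [← Real.exp_add, ← Real.exp_add]
      ring_nf
    have h2 : c - F ≤ Real.exp (c - F - 1) := by linarith [Real.add_one_le_exp (c - F - 1)]
    have h3 : (2 : ℝ) ≤ Real.exp 1 := by linarith [Real.add_one_le_exp (1 : ℝ)]
    have h4 : 2 * (c - F) ≤ Real.exp 1 * Real.exp (c - F - 1) :=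
      mul_le_mul h3 h2 (by linarith) (by linarith)
    have h5 := mul_le_mul_of_nonneg_left h4 hF.le
    rw [h1]
    linarith

/-- Integrability of the divergence forces that of e^F: once F ≥ c + 2, the factor |c - F| - 1 in
the coercivity bound is at least 1. -/
theorem exp_le_bregman_add (c F : ℝ) : Real.exp F ≤ bregman c F + Real.exp (c + 2) := by
  have h := exp_mul_abs_sub_le_bregman c F
  rcases le_total F (c + 2) with h1 | h1
  · linarith [Real.exp_le_exp.2 h1, bregman_nonneg c F]
  · rw [abs_of_nonpos (by linarith)] at h
    have : Real.exp F * 1 ≤ Real.exp F * (-(c - F) - 1) :=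
      mul_le_mul_of_nonneg_left (by linarith) (Real.exp_pos F).le
    linarith [Real.exp_pos (c + 2)]

theorem integral_bregman {Ω : Type*} [MeasurableSpace Ω] {P : Measure Ω} [IsProbabilityMeasure P]
    {f : Ω → ℝ} (hE : Integrable (fun ω => Real.exp (f ω)) P)
    (hL : Integrable (fun ω => Real.exp (f ω) * f ω) P) (c : ℝ) :
    Integrable (fun ω => bregman c (f ω)) P ∧ ∫ ω, bregman c (f ω) ∂P
      = ∫ ω, Real.exp (f ω) * f ω ∂P - c * ∫ ω, Real.exp (f ω) ∂P
        - ∫ ω, Real.exp (f ω) ∂P + Real.exp c := by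
  have h1 : (fun ω => bregman c (f ω)) = fun ω => Real.exp (f ω) * f ω - c * Real.exp (f ω)
      - Real.exp (f ω) + Real.exp c := by
    funext ω
    rw [bregman]
    ring
  have i1 : Integrable (fun ω => Real.exp (f ω) * f ω - c * Real.exp (f ω)) P :=
    hL.sub (hE.const_mul c)
  have i2 : Integrable (fun ω => Real.exp (f ω) * f ω - c * Real.exp (f ω) - Real.exp (f ω)) P :=
    i1.sub hE
  rw [h1]
  refine ⟨i2.add (integrable_const _), ?_⟩
  rw [integral_add i2 (integrable_const _), integral_sub i1 hE, integral_sub hL (hE.const_mul c),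
    integral_const_mul]
  simp

/-- The Bregman functional dominates the entropy of `exp f`, for every base point. -/
theorem Ent_exp_le {Ω : Type*} [MeasurableSpace Ω] {P : Measure Ω} [IsProbabilityMeasure P]
    {f : Ω → ℝ} (hf : Measurable f) (c : ℝ) :
    Ent P (fun ω => Real.exp (f ω)) ≤ ((∫⁻ ω, ENNReal.ofReal (bregman c (f ω)) ∂P : ℝ≥0∞) : EReal) := by
  by_cases htop : ∫⁻ ω, ENNReal.ofReal (bregman c (f ω)) ∂P = ⊤
  · simp [htop]
  have hbm : Measurable fun ω => bregman c (f ω) := (continuous_bregman c).measurable.comp hf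
  have hB : Integrable (fun ω => bregman c (f ω)) P :=
    (lintegral_ofReal_ne_top_iff_integrable hbm.aestronglyMeasurable
      (Filter.Eventually.of_forall fun _ => bregman_nonneg _ _)).1 htop
  have hE : Integrable (fun ω => Real.exp (f ω)) P := by
    refine (hB.add (integrable_const (Real.exp (c + 2)))).mono'
      hf.exp.aestronglyMeasurable (Filter.Eventually.of_forall fun ω => ?_)
    rw [Real.norm_of_nonneg (Real.exp_pos _).le]
    exact exp_le_bregman_add _ _
  have hL : Integrable (fun ω => Real.exp (f ω) * f ω) P := by
    have := ((hB.add (hE.const_mul c)).add hE).sub (integrable_const (Real.exp c))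
    refine this.congr (Filter.Eventually.of_forall fun ω => ?_)
    simp only [Pi.add_apply, Pi.sub_apply, bregman]
    ring
  have hM := integral_exp_pos hE
  have hval := (integral_bregman hE hL c).2
  -- The integral of B_c(f) exceeds the entropy by exactly B_c(log E e^f).
  have h2 := bregman_nonneg c (Real.log (∫ ω, Real.exp (f ω) ∂P))
  rw [bregman, Real.exp_log hM] at h2
  rw [Ent, if_pos (by simpa only [Real.log_exp] using hL),
    ← ofReal_integral_eq_lintegral_ofReal hB
      (Filter.Eventually.of_forall fun _ => bregman_nonneg _ _), EReal.coe_ennreal_ofReal,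
    EReal.coe_le_coe_iff]
  simp only [Real.log_exp]
  refine le_trans ?_ (le_max_left _ _)
  rw [hval]
  linarith

/-! ### Variational formula and subadditivity of entropy for bounded functions -/

/-- The entropy of `exp f`, for bounded `f`. -/
noncomputable def expEnt {α : Type*} [MeasurableSpace α] (P : Measure α) (f : α → ℝ) : ℝ :=
  ∫ x, Real.exp (f x) * f x ∂P - (∫ x, Real.exp (f x) ∂P) * Real.log (∫ x, Real.exp (f x) ∂P)

section Bounded

variable {α γ : Type*} [MeasurableSpace α] [MeasurableSpace γ]

theorem integrable_of_abs_le {P : Measure α} [IsFiniteMeasure P] {f : α → ℝ} (hf : Measurable f)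
    {C : ℝ} (h : ∀ x, |f x| ≤ C) : Integrable f P :=
  Integrable.of_bound hf.aestronglyMeasurable C (Filter.Eventually.of_forall h)

theorem abs_exp_le {k a : ℝ} (h : |a| ≤ k) : |Real.exp a| ≤ Real.exp k := by
  rw [Real.abs_exp]
  exact Real.exp_le_exp.2 ((le_abs_self a).trans h)

theorem abs_exp_mul_le {k l a b : ℝ} (h : |a| ≤ k) (hb : |b| ≤ l) :
    |Real.exp a * b| ≤ Real.exp k * l := by
  rw [abs_mul]
  exact mul_le_mul (abs_exp_le h) hb (abs_nonneg _) (Real.exp_pos _).le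

theorem integral_exp_bounds {P : Measure α} [IsProbabilityMeasure P] {f : α → ℝ}
    (hf : Measurable f) {k : ℝ} (h : ∀ x, |f x| ≤ k) :
    Real.exp (-k) ≤ ∫ x, Real.exp (f x) ∂P ∧ ∫ x, Real.exp (f x) ∂P ≤ Real.exp k := by
  have hi : Integrable (fun x => Real.exp (f x)) P :=
    integrable_of_abs_le hf.exp fun x => abs_exp_le (h x)
  constructor
  · have := integral_mono (μ := P) (integrable_const (Real.exp (-k))) hi
      fun x => Real.exp_le_exp.2 (abs_le.1 (h x)).1
    simpa using this
  · have := integral_mono (μ := P) hi (integrable_const (Real.exp k))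
      fun x => Real.exp_le_exp.2 (abs_le.1 (h x)).2
    simpa using this

theorem abs_log_integral_exp_le {P : Measure α} [IsProbabilityMeasure P] {f : α → ℝ}
    (hf : Measurable f) {k : ℝ} (h : ∀ x, |f x| ≤ k) :
    |Real.log (∫ x, Real.exp (f x) ∂P)| ≤ k := by
  obtain ⟨h1, h2⟩ := integral_exp_bounds (P := P) hf h
  have hpos := (Real.exp_pos (-k)).trans_le h1
  rw [abs_le]
  constructor
  · rwa [Real.le_log_iff_exp_le hpos]
  · rwa [Real.log_le_iff_le_exp hpos]

/-- The entropy of `exp f` as a Bregman functional. -/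
theorem ofReal_expEnt_eq {P : Measure α} [IsProbabilityMeasure P] {f : α → ℝ}
    (hf : Measurable f) {k : ℝ} (h : ∀ x, |f x| ≤ k) (c : ℝ) :
    ∫⁻ x, ENNReal.ofReal (bregman c (f x)) ∂P = ENNReal.ofReal (expEnt P f
      + bregman c (Real.log (∫ x, Real.exp (f x) ∂P))) := by
  have hE : Integrable (fun x => Real.exp (f x)) P :=
    integrable_of_abs_le hf.exp fun x => abs_exp_le (h x)
  have hL : Integrable (fun x => Real.exp (f x) * f x) P :=
    integrable_of_abs_le (hf.exp.mul hf) fun x => abs_exp_mul_le (h x) (h x)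
  have hM := integral_exp_pos hE
  obtain ⟨hB, hval⟩ := integral_bregman hE hL c
  rw [← ofReal_integral_eq_lintegral_ofReal hB
      (Filter.Eventually.of_forall fun _ => bregman_nonneg _ _), hval, expEnt, bregman,
    Real.exp_log hM]
  congr 1
  ring

theorem ofReal_expEnt_le {P : Measure α} [IsProbabilityMeasure P] {f : α → ℝ}
    (hf : Measurable f) {k : ℝ} (h : ∀ x, |f x| ≤ k) (c : ℝ) :
    ENNReal.ofReal (expEnt P f) ≤ ∫⁻ x, ENNReal.ofReal (bregman c (f x)) ∂P := by
  rw [ofReal_expEnt_eq hf h]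
  exact ENNReal.ofReal_le_ofReal (by linarith [bregman_nonneg c (Real.log (∫ x, Real.exp (f x) ∂P))])

/-- Variational bound for the entropy. -/
theorem integral_exp_mul_le_expEnt {P : Measure α} [IsProbabilityMeasure P] {f g : α → ℝ}
    (hf : Measurable f) {k : ℝ} (h : ∀ x, |f x| ≤ k)
    (hg : Measurable g) {l : ℝ} (hl : ∀ x, |g x| ≤ l) (hg1 : ∫ x, Real.exp (g x) ∂P = 1) :
    ∫ x, Real.exp (f x) * g x ∂P ≤ expEnt P f := by
  have hE : Integrable (fun x => Real.exp (f x)) P :=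
    integrable_of_abs_le hf.exp fun x => abs_exp_le (h x)
  have hL : Integrable (fun x => Real.exp (f x) * f x) P :=
    integrable_of_abs_le (hf.exp.mul hf) fun x => abs_exp_mul_le (h x) (h x)
  have hG : Integrable (fun x => Real.exp (f x) * g x) P :=
    integrable_of_abs_le (hf.exp.mul hg) fun x => abs_exp_mul_le (h x) (hl x)
  have hEg : Integrable (fun x => Real.exp (g x)) P :=
    integrable_of_abs_le hg.exp fun x => abs_exp_le (hl x)
  have hM := integral_exp_pos hE
  set M := ∫ x, Real.exp (f x) ∂P with hMdef
  have h0 : 0 ≤ ∫ x, (Real.exp (f x) * f x - Real.log M * Real.exp (f x)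
      - Real.exp (f x) * g x - Real.exp (f x) + M * Real.exp (g x)) ∂P := by
    refine integral_nonneg fun x => ?_
    -- With base point log M + g the last term is M e^g, whose integral M cancels that of e^f.
    have := bregman_nonneg (Real.log M + g x) (f x)
    rw [bregman, Real.exp_add, Real.exp_log hM] at this
    simp only [Pi.zero_apply]
    linarith
  have i1 : Integrable (fun x => Real.exp (f x) * f x - Real.log M * Real.exp (f x)) P :=
    hL.sub (hE.const_mul _)
  have i2 : Integrable (fun x => Real.exp (f x) * f x - Real.log M * Real.exp (f x)
      - Real.exp (f x) * g x) P := i1.sub hG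
  have i3 : Integrable (fun x => Real.exp (f x) * f x - Real.log M * Real.exp (f x)
      - Real.exp (f x) * g x - Real.exp (f x)) P := i2.sub hE
  rw [integral_add i3 (hEg.const_mul _), integral_sub i2 hE,
    integral_sub i1 hG, integral_sub hL (hE.const_mul _),
    integral_const_mul, integral_const_mul, hg1, ← hMdef] at h0
  rw [expEnt, ← hMdef]
  linarith

theorem expEnt_nonneg {P : Measure α} [IsProbabilityMeasure P] {f : α → ℝ}
    (hf : Measurable f) {k : ℝ} (h : ∀ x, |f x| ≤ k) : 0 ≤ expEnt P f := by
  have := integral_exp_mul_le_expEnt (P := P) (g := fun _ => 0) hf h measurable_const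
    (l := 0) (by simp) (by simp)
  simpa using this

theorem measurable_expEnt_right {P : Measure γ} [IsProbabilityMeasure P] {F : α × γ → ℝ}
    (hF : Measurable F) : Measurable fun x => expEnt P fun y => F (x, y) := by
  have h1 : Measurable fun x => ∫ y, Real.exp (F (x, y)) ∂P :=
    (hF.exp.stronglyMeasurable.integral_prod_right' (ν := P)).measurable
  have h2 : Measurable fun x => ∫ y, Real.exp (F (x, y)) * F (x, y) ∂P :=
    ((hF.exp.mul hF).stronglyMeasurable.integral_prod_right' (ν := P)).measurable
  exact h2.sub (h1.mul h1.log)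

theorem abs_expEnt_le {P : Measure α} [IsProbabilityMeasure P] {f : α → ℝ}
    (hf : Measurable f) {k : ℝ} (h : ∀ x, |f x| ≤ k) :
    |expEnt P f| ≤ Real.exp k * k + Real.exp k * k := by
  have h1 : |∫ x, Real.exp (f x) * f x ∂P| ≤ Real.exp k * k := by
    have := norm_integral_le_of_norm_le_const (μ := P) (f := fun x => Real.exp (f x) * f x)
      (Filter.Eventually.of_forall fun x => abs_exp_mul_le (h x) (h x))
    simpa using this
  obtain ⟨h2, h3⟩ := integral_exp_bounds (P := P) hf h
  have h4 := abs_log_integral_exp_le (P := P) hf h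
  have hpos := (Real.exp_pos (-k)).trans_le h2
  refine (abs_sub _ _).trans (add_le_add h1 ?_)
  rw [abs_mul, abs_of_pos hpos]
  exact mul_le_mul h3 h4 (abs_nonneg _) (Real.exp_pos _).le

/-- Subadditivity of entropy for a product of two probability spaces. -/
theorem expEnt_prod_le {P : Measure α} {Q : Measure γ} [IsProbabilityMeasure P]
    [IsProbabilityMeasure Q] {F : α × γ → ℝ} (hF : Measurable F) {k : ℝ} (h : ∀ z, |F z| ≤ k) :
    expEnt (P.prod Q) F ≤ ∫ x, expEnt Q (fun y => F (x, y)) ∂P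
      + ∫ y, expEnt P (fun x => F (x, y)) ∂Q := by
  have hsec1 : ∀ x, Measurable fun y => F (x, y) := fun x => hF.comp measurable_prodMk_left
  have hsec2 : ∀ y, Measurable fun x => F (x, y) := fun y => hF.comp measurable_prodMk_right
  have hE : Integrable (fun z => Real.exp (F z)) (P.prod Q) :=
    integrable_of_abs_le hF.exp fun x => abs_exp_le (h x)
  have hL : Integrable (fun z => Real.exp (F z) * F z) (P.prod Q) :=
    integrable_of_abs_le (hF.exp.mul hF) fun x => abs_exp_mul_le (h x) (h x)
  set N : α → ℝ := fun x => ∫ y, Real.exp (F (x, y)) ∂Q with hN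
  have hNm : Measurable N := (hF.exp.stronglyMeasurable.integral_prod_right' (ν := Q)).measurable
  have hNb : ∀ x, Real.exp (-k) ≤ N x ∧ N x ≤ Real.exp k := fun x =>
    integral_exp_bounds (hsec1 x) fun y => h (x, y)
  have hNlog : ∀ x, |Real.log (N x)| ≤ k := fun x =>
    abs_log_integral_exp_le (hsec1 x) fun y => h (x, y)
  have hNpos : ∀ x, 0 < N x := fun x => (Real.exp_pos _).trans_le (hNb x).1
  have hNabs : ∀ x, |N x| ≤ Real.exp k := fun x => by
    rw [abs_of_pos (hNpos x)]
    exact (hNb x).2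
  have hNint : Integrable N P := integrable_of_abs_le hNm hNabs
  have hNlogint : Integrable (fun x => N x * Real.log (N x)) P :=
    integrable_of_abs_le (C := Real.exp k * k) (hNm.mul hNm.log) fun x => by
      rw [abs_mul]
      exact mul_le_mul (hNabs x) (hNlog x) (abs_nonneg _) (Real.exp_pos _).le
  set M := ∫ z, Real.exp (F z) ∂(P.prod Q) with hM
  have hMN : M = ∫ x, N x ∂P := integral_prod _ hE
  have hMpos : 0 < M := integral_exp_pos hE
  have hMlog : |Real.log M| ≤ k := abs_log_integral_exp_le hF h
  have hfst : ∫ x, expEnt Q (fun y => F (x, y)) ∂P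
      = ∫ z, Real.exp (F z) * F z ∂(P.prod Q) - ∫ x, N x * Real.log (N x) ∂P := by
    rw [integral_prod _ hL, ← integral_sub hL.integral_prod_left hNlogint]
    rfl
  -- The entropy of the marginal N equals ∫ N g. Since g does not depend on y and e^g has mean 1, it
  -- is an admissible test function for every section in x.
  set g : α → ℝ := fun x => Real.log (N x) - Real.log M with hg
  have hgm : Measurable g := hNm.log.sub_const _
  have hgb : ∀ x, |g x| ≤ k + k := fun x => (abs_sub _ _).trans (add_le_add (hNlog x) hMlog)
  have hg1 : ∫ x, Real.exp (g x) ∂P = 1 := by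
    have : ∀ x, Real.exp (g x) = N x / M := fun x => by
      rw [hg, Real.exp_sub, Real.exp_log (hNpos x), Real.exp_log hMpos]
    simp_rw [this]
    rw [integral_div, ← hMN, div_self hMpos.ne']
  have hFg : Integrable (fun z : α × γ => Real.exp (F z) * g z.1) (P.prod Q) :=
    integrable_of_abs_le (hF.exp.mul (hgm.comp measurable_fst))
      fun z => abs_exp_mul_le (h z) (hgb z.1)
  have hent : Integrable (fun y => expEnt P fun x => F (x, y)) Q :=
    integrable_of_abs_le (measurable_expEnt_right (hF.comp measurable_swap))
      fun y => abs_expEnt_le (hsec2 y) fun x => h (x, y)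
  have hsnd : ∫ x, N x * Real.log (N x) ∂P - M * Real.log M
      ≤ ∫ y, expEnt P (fun x => F (x, y)) ∂Q := by
    calc ∫ x, N x * Real.log (N x) ∂P - M * Real.log M
        = ∫ x, N x * g x ∂P := by
          simp_rw [hg, mul_sub]
          rw [integral_sub hNlogint (hNint.mul_const _), integral_mul_const, ← hMN]
      _ = ∫ x, ∫ y, Real.exp (F (x, y)) * g x ∂Q ∂P := by
          simp_rw [integral_mul_const, hN]
      _ = ∫ y, ∫ x, Real.exp (F (x, y)) * g x ∂P ∂Q := integral_integral_swap hFg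
      _ ≤ _ := integral_mono hFg.integral_prod_right hent fun y =>
          integral_exp_mul_le_expEnt (hsec2 y) (fun x => h (x, y)) hgm hgb hg1
  rw [hfst]
  change ∫ z, Real.exp (F z) * F z ∂(P.prod Q) - M * Real.log M ≤ _
  linarith

end Bounded

/-- Subadditivity of entropy for a finite product of probability measures on `ℝ`, with the entropies
of the sections replaced by upper bounds. -/
theorem ofReal_expEnt_pi_le {k : ℝ} : ∀ {n : ℕ} (μ : Fin n → Measure ℝ)
    [∀ i, IsProbabilityMeasure (μ i)] (F : (Fin n → ℝ) → ℝ) (T : Fin n → (Fin n → ℝ) → ℝ≥0∞),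
    Measurable F → (∀ x, |F x| ≤ k) → (∀ i, Measurable (T i)) →
    (∀ i x, ENNReal.ofReal (expEnt (μ i) fun t => F (Function.update x i t))
      ≤ ∫⁻ t, T i (Function.update x i t) ∂(μ i)) →
    ENNReal.ofReal (expEnt (Measure.pi μ) F) ≤ ∑ i, ∫⁻ x, T i x ∂(Measure.pi μ)
  | 0, μ, _, F, T, hF, hk, hT, h => by
    have : expEnt (Measure.pi μ) F = 0 := by
      have e : F = fun _ => F 0 := by
        funext x
        rw [Subsingleton.elim x 0]
      rw [e, expEnt]
      simp
    simp [this]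
  | n + 1, μ, _, F, T, hF, hk, hT, h => by
    have mp := (measurePreserving_piFinSuccAbove μ 0).symm
    set ν : Measure (Fin n → ℝ) := Measure.pi fun j => μ (Fin.succAbove 0 j) with hν
    set e := (MeasurableEquiv.piFinSuccAbove (fun _ : Fin (n + 1) => ℝ) 0).symm with he
    have hcons : ∀ p : ℝ × (Fin n → ℝ), e p = Fin.cons p.1 p.2 := fun p => by
      rw [he]
      exact Fin.insertNth_zero' p.1 p.2
    have hem : Measurable e := e.measurable
    have h1 : expEnt (Measure.pi μ) F = expEnt ((μ 0).prod ν) fun p => F (e p) := by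
      rw [expEnt, expEnt, mp.integral_comp' (fun x => Real.exp (F x) * F x),
        mp.integral_comp' (fun x => Real.exp (F x))]
    have h2 : ∀ i, ∫⁻ x, T i x ∂(Measure.pi μ) = ∫⁻ p, T i (e p) ∂((μ 0).prod ν) := fun i =>
      (mp.lintegral_comp (hT i)).symm
    have hFe : Measurable fun p => F (e p) := hF.comp hem
    have hsec1 : ∀ t, Measurable fun y => F (e (t, y)) := fun t => hFe.comp measurable_prodMk_left
    have hsec2 : ∀ y, Measurable fun t => F (e (t, y)) := fun y => hFe.comp measurable_prodMk_right
    have hb : ∀ p, |F (e p)| ≤ k := fun p => hk _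
    have hi1 : Integrable (fun t => expEnt ν fun y => F (e (t, y))) (μ 0) :=
      integrable_of_abs_le (measurable_expEnt_right hFe)
        fun t => abs_expEnt_le (hsec1 t) fun y => hb _
    have hi2 : Integrable (fun y => expEnt (μ 0) fun t => F (e (t, y))) ν :=
      integrable_of_abs_le (measurable_expEnt_right (hFe.comp measurable_swap))
        fun y => abs_expEnt_le (hsec2 y) fun t => hb _
    have rest : ∀ t, ENNReal.ofReal (expEnt ν fun y => F (e (t, y)))
        ≤ ∑ j : Fin n, ∫⁻ y, T j.succ (e (t, y)) ∂ν := fun t => by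
      refine ofReal_expEnt_pi_le (fun j => μ (Fin.succAbove 0 j)) (fun y => F (e (t, y)))
        (fun j y => T j.succ (e (t, y))) (hsec1 t) (fun y => hb _)
        (fun j => ((hT j.succ).comp hem).comp measurable_prodMk_left) fun j y => ?_
      have := h j.succ (Fin.cons t y)
      simp only [hcons, Fin.cons_update, Fin.succAbove_zero]
      exact this
    have first : ∀ y, ENNReal.ofReal (expEnt (μ 0) fun t => F (e (t, y)))
        ≤ ∫⁻ t, T 0 (e (t, y)) ∂(μ 0) := fun y => by
      -- The first entry 0 is arbitrary: the update overwrites it.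
      have := h 0 (Fin.cons 0 y)
      simp only [Fin.update_cons_zero] at this
      simpa only [hcons] using this
    rw [h1, Fin.sum_univ_succ]
    simp_rw [h2]
    calc ENNReal.ofReal (expEnt ((μ 0).prod ν) fun p => F (e p))
        ≤ ENNReal.ofReal (∫ t, expEnt ν (fun y => F (e (t, y))) ∂(μ 0))
          + ENNReal.ofReal (∫ y, expEnt (μ 0) (fun t => F (e (t, y))) ∂ν) :=
          (ENNReal.ofReal_le_ofReal (expEnt_prod_le hFe hb)).trans ENNReal.ofReal_add_le
      _ = ∫⁻ t, ENNReal.ofReal (expEnt ν fun y => F (e (t, y))) ∂(μ 0)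
          + ∫⁻ y, ENNReal.ofReal (expEnt (μ 0) fun t => F (e (t, y))) ∂ν := by
          rw [ofReal_integral_eq_lintegral_ofReal hi1 (Filter.Eventually.of_forall fun t =>
              expEnt_nonneg (hsec1 t) fun y => hb _),
            ofReal_integral_eq_lintegral_ofReal hi2 (Filter.Eventually.of_forall fun y =>
              expEnt_nonneg (hsec2 y) fun t => hb _)]
      _ ≤ ∫⁻ t, ∑ j : Fin n, ∫⁻ y, T j.succ (e (t, y)) ∂ν ∂(μ 0)
          + ∫⁻ y, ∫⁻ t, T 0 (e (t, y)) ∂(μ 0) ∂ν :=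
          add_le_add (lintegral_mono rest) (lintegral_mono first)
      _ = ∑ j : Fin n, ∫⁻ p, T j.succ (e p) ∂((μ 0).prod ν)
          + ∫⁻ p, T 0 (e p) ∂((μ 0).prod ν) := by
          rw [lintegral_finsetSum _ fun j _ => ((hT j.succ).comp hem).lintegral_prod_right']
          congr 1
          · refine Finset.sum_congr rfl fun j _ => ?_
            exact (lintegral_prod (fun p => T j.succ (e p))
              ((hT j.succ).comp hem).aemeasurable).symm
          · exact (lintegral_prod_symm (fun p => T 0 (e p))
              ((hT 0).comp hem).aemeasurable).symm
      _ = _ := add_comm _ _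

/-! ### Removing the truncation -/

/-- Truncation of a real number to `[-k, k]`. -/
noncomputable def clamp (k x : ℝ) : ℝ := max (min x k) (-k)

theorem bregman_clamp_le (k c F : ℝ) : bregman (clamp k c) (clamp k F) ≤ bregman c F :=
  (bregman_max_le _ _ _).trans (bregman_min_le _ _ _)

theorem measurable_clamp (k : ℝ) : Measurable (clamp k) :=
  (measurable_id.min measurable_const).max measurable_const

theorem abs_clamp_le {k : ℝ} (hk : 0 ≤ k) (x : ℝ) : |clamp k x| ≤ k := by
  rw [abs_le, clamp]
  exact ⟨le_max_right _ _, max_le (min_le_right _ _) (by linarith)⟩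

theorem clamp_of_abs_le {k x : ℝ} (h : |x| ≤ k) : clamp k x = x := by
  rw [clamp, min_eq_left (abs_le.1 h).2, max_eq_left (abs_le.1 h).1]

/-- Uniform entropy bounds for the truncations of `F` pass to `F`. -/
theorem exists_lintegral_bregman_le_of_clamp {α : Type*} [MeasurableSpace α] {P : Measure α}
    [IsProbabilityMeasure P] {F : α → ℝ} (hF : Measurable F) {K : ℝ≥0∞}
    (h : ∀ k : ℕ, ENNReal.ofReal (expEnt P fun x => clamp k (F x)) ≤ K) :
    ∃ c, ∫⁻ x, ENNReal.ofReal (bregman c (F x)) ∂P ≤ K := by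
  let c : ℕ → ℝ := fun k => Real.log (∫ x, Real.exp (clamp k (F x)) ∂P)
  have hc : ∀ k : ℕ, ∫⁻ x, ENNReal.ofReal (bregman (c k) (clamp k (F x))) ∂P ≤ K := fun k => by
    have hm : Measurable fun x => clamp k (F x) := (measurable_clamp k).comp hF
    rw [ofReal_expEnt_eq hm
      (fun x => abs_clamp_le (Nat.cast_nonneg k) (F x)), bregman_self, add_zero]
    exact h k
  -- The optimal base points of the truncations have no a priori bound, so the limit is taken in the
  -- compact space `EReal`.
  obtain ⟨a, -, ψ, hψ, hlim⟩ := isCompact_univ.tendsto_subseq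
    (x := fun k => (c k : EReal)) fun _ => Set.mem_univ _
  have hclamp : ∀ x, ∀ᶠ j in Filter.atTop, clamp (ψ j : ℕ) (F x) = F x := fun x => by
    filter_upwards [hψ.tendsto_atTop.eventually_ge_atTop ⌈|F x|⌉₊] with j hj
    exact clamp_of_abs_le (Nat.ceil_le.1 hj)
  have fatou : ∀ L : α → ℝ≥0∞, (∀ x, Filter.Tendsto
      (fun j => ENNReal.ofReal (bregman (c (ψ j)) (F x))) Filter.atTop (nhds (L x))) →
      ∫⁻ x, L x ∂P ≤ K := fun L hL => by
    have e : ∀ x, L x = Filter.liminf (fun j => ENNReal.ofReal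
        (bregman (c (ψ j)) (clamp (ψ j : ℕ) (F x)))) Filter.atTop := fun x => by
      refine (((hL x).congr' ?_).liminf_eq).symm
      filter_upwards [hclamp x] with j hj
      rw [hj]
    simp_rw [e]
    refine (lintegral_liminf_le fun j => ?_).trans ?_
    · exact ((continuous_bregman _).measurable.comp
        ((measurable_clamp _).comp hF)).ennreal_ofReal
    · refine (Filter.liminf_le_liminf (Filter.Eventually.of_forall fun j => hc (ψ j))).trans ?_
      simp
  have unbounded : Filter.Tendsto (fun j => |c (ψ j)|) Filter.atTop Filter.atTop →
      ∃ c, ∫⁻ x, ENNReal.ofReal (bregman c (F x)) ∂P ≤ K := fun habs => by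
    -- By coercivity, escaping base points make the integrands tend to ∞ everywhere; Fatou then
    -- forces K = ∞ and any c serves.
    have := fatou (fun _ => ⊤) fun x => by
      refine ENNReal.tendsto_ofReal_nhds_top.2 ?_
      refine Filter.tendsto_atTop_mono (fun j => exp_mul_abs_sub_le_bregman (c (ψ j)) (F x)) ?_
      refine Filter.Tendsto.const_mul_atTop (Real.exp_pos _) ?_
      refine Filter.tendsto_atTop_mono (fun j => ?_)
        (Filter.tendsto_atTop_add_const_right _ (-|F x| - 1) habs)
      have := abs_sub_abs_le_abs_sub (c (ψ j)) (F x)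
      linarith
    rw [lintegral_const, measure_univ, mul_one, top_le_iff] at this
    exact ⟨0, this ▸ le_top⟩
  induction a with
  | bot =>
    refine unbounded (Filter.tendsto_abs_atBot_atTop.comp ?_)
    exact EReal.tendsto_coe_nhds_bot_iff.1 hlim
  | top =>
    refine unbounded (Filter.tendsto_abs_atTop_atTop.comp ?_)
    exact EReal.tendsto_coe_nhds_top_iff.1 hlim
  | coe a =>
    have hlim' : Filter.Tendsto (fun j => c (ψ j)) Filter.atTop (nhds a) :=
      EReal.tendsto_coe.1 hlim
    refine ⟨a, fatou _ fun x => ?_⟩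
    have hcont : Continuous fun c => ENNReal.ofReal (bregman c (F x)) := by
      refine ENNReal.continuous_ofReal.comp ?_
      unfold bregman
      fun_prop
    exact (hcont.tendsto a).comp hlim'

/-! ### Uniform moment and mass bounds over the class -/

/-- A bound for the second moment of the members of the class `M_β(m, s)`. -/
noncomputable def momentBound (β m s : ℝ) : ℝ :=
  m ^ 2 + 2 * (2 * (m ^ 2 + s * (2 * (s + 1) / (m ^ β) ^ 2)))

theorem momentBound_nonneg {β m s : ℝ} (hs : 0 ≤ s) : 0 ≤ momentBound β m s := by
  unfold momentBound
  positivity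

/-- A radius such that every member of the class has mass at least `1 / 2` within it. -/
noncomputable def massRadius (β m s : ℝ) : ℝ := m + 2 * momentBound β m s + 1

theorem le_massRadius {β m s : ℝ} (hs : 0 ≤ s) : m ≤ massRadius β m s := by
  have := momentBound_nonneg (β := β) (m := m) hs
  unfold massRadius
  linarith

theorem ClassM.left_tail_map_neg {β m s : ℝ} (hm : 0 < m) {μ : Measure ℝ} (h : ClassM β m s μ) :
    ∀ x, m ≤ x → nuPlus β m (μ.map Neg.neg) (Set.Ici x)
      ≤ ENNReal.ofReal s * μ.map Neg.neg (Set.Ici x) := by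
  intro x hx
  have hset : (Neg.neg ⁻¹' Set.Ici x : Set ℝ) = Set.Iic (-x) := by
    ext y
    simp only [Set.mem_preimage, Set.mem_Ici, Set.mem_Iic]
    constructor <;> intro h <;> linarith
  rw [nuPlus_map_neg hm.le, Measure.map_apply measurable_neg measurableSet_Ici, hset]
  exact h.left_tail (-x) (by linarith)

theorem ClassM.lintegral_sq_le {β m s : ℝ} (hβ : 0 ≤ β) (hm : 0 < m) (hs : 0 ≤ s)
    {μ : Measure ℝ} (h : ClassM β m s μ) :
    ∫⁻ t, ENNReal.ofReal (t ^ 2) ∂μ ≤ ENNReal.ofReal (momentBound β m s) := by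
  have := h.isProbabilityMeasure
  have : IsProbabilityMeasure (μ.map Neg.neg) :=
    Measure.isProbabilityMeasure_map measurable_neg.aemeasurable
  set B := 2 * (m ^ 2 + s * (2 * (s + 1) / (m ^ β) ^ 2)) with hB
  have hB0 : 0 ≤ B := by positivity
  have right := setLIntegral_sq_le hβ hm hs h.right_tail
  have left := setLIntegral_sq_le hβ hm hs (h.left_tail_map_neg hm)
  have hneg := setLIntegral_Ici_map_neg μ m (fun t => ENNReal.ofReal (t ^ 2))
  simp only [neg_sq] at hneg
  rw [hneg] at left
  have middle : ∫⁻ t in Set.Icc (-m) m, ENNReal.ofReal (t ^ 2) ∂μ ≤ ENNReal.ofReal (m ^ 2) := by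
    calc ∫⁻ t in Set.Icc (-m) m, ENNReal.ofReal (t ^ 2) ∂μ
        ≤ ∫⁻ _ in Set.Icc (-m) m, ENNReal.ofReal (m ^ 2) ∂μ :=
          setLIntegral_mono' measurableSet_Icc fun t ht =>
            ENNReal.ofReal_le_ofReal (sq_le_sq' ht.1 ht.2)
      _ ≤ _ := by
          rw [setLIntegral_const]
          exact mul_le_of_le_one_right' prob_le_one
  have hun : (Set.univ : Set ℝ) = Set.Iic (-m) ∪ Set.Icc (-m) m ∪ Set.Ici m := by
    ext t
    simp only [Set.mem_univ, Set.mem_union, Set.mem_Iic, Set.mem_Icc, Set.mem_Ici, true_iff]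
    by_cases h1 : t ≤ -m
    · exact Or.inl (Or.inl h1)
    · by_cases h2 : m ≤ t
      · exact Or.inr h2
      · exact Or.inl (Or.inr ⟨by linarith, by linarith⟩)
  rw [← setLIntegral_univ, hun]
  refine (lintegral_union_le _ _ _).trans ?_
  refine (add_le_add ((lintegral_union_le _ _ _).trans (add_le_add left middle)) right).trans ?_
  rw [← ENNReal.ofReal_add hB0 (by positivity), ← ENNReal.ofReal_add (by positivity) hB0]
  refine ENNReal.ofReal_le_ofReal ?_
  rw [momentBound, ← hB]
  linarith

theorem ClassM.half_le_measure_Icc {β m s : ℝ} (hβ : 0 ≤ β) (hm : 0 < m) (hs : 0 ≤ s)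
    {μ : Measure ℝ} (h : ClassM β m s μ) :
    1 / 2 ≤ μ (Set.Icc (-massRadius β m s) (massRadius β m s)) := by
  have := h.isProbabilityMeasure
  have hV := momentBound_nonneg (β := β) (m := m) hs
  set V := momentBound β m s with hVdef
  set R := massRadius β m s with hR
  have hRV : R = m + 2 * V + 1 := rfl
  have hR0 : 0 < R := by linarith
  -- Since R ≥ 2V + 1 ≥ 1, squaring only enlarges it; Chebyshev then gives V / R² ≤ 1/2.
  have hR2 : 2 * V + 1 ≤ R ^ 2 := by nlinarith
  have hcheb : μ (Set.Icc (-R) R)ᶜ ≤ 1 / 2 := by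
    have hmark := meas_ge_le_lintegral_div (μ := μ) (f := fun t : ℝ => ENNReal.ofReal (t ^ 2))
      (by fun_prop) (ε := ENNReal.ofReal (R ^ 2)) (by positivity) ENNReal.ofReal_ne_top
    calc μ (Set.Icc (-R) R)ᶜ ≤ μ {t | ENNReal.ofReal (R ^ 2) ≤ ENNReal.ofReal (t ^ 2)} := by
          refine measure_mono fun t ht => ?_
          refine ENNReal.ofReal_le_ofReal (sq_le_sq.2 ?_)
          rw [abs_of_pos hR0]
          by_contra hlt
          exact ht (abs_le.1 (not_le.1 hlt).le)
      _ ≤ _ := hmark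
      _ ≤ ENNReal.ofReal V / ENNReal.ofReal (R ^ 2) := by
          gcongr
          exact h.lintegral_sq_le hβ hm hs
      _ = ENNReal.ofReal (V / R ^ 2) := (ENNReal.ofReal_div_of_pos (by positivity)).symm
      _ ≤ ENNReal.ofReal (1 / 2) := by
          refine ENNReal.ofReal_le_ofReal ?_
          rw [div_le_div_iff₀ (by positivity) (by positivity)]
          linarith
      _ = 1 / 2 := by
          rw [ENNReal.ofReal_div_of_pos (by norm_num)]
          simp
  have hadd := prob_add_prob_compl (μ := μ) (measurableSet_Icc (a := -R) (b := R))
  by_contra hlt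
  have hlt := not_le.1 hlt
  have : μ (Set.Icc (-R) R) + μ (Set.Icc (-R) R)ᶜ < 1 := by
    calc _ < 1 / 2 + 1 / 2 := ENNReal.add_lt_add_of_lt_of_le
          (ne_top_of_le_ne_top (by simp) hcheb) hlt hcheb
      _ = 1 := by simpa using ENNReal.add_halves 1
  exact this.ne hadd

/-- The constant in the one-dimensional inequality. -/
noncomputable def lineConst (β m s K : ℝ) : ℝ :=
  4 * (4 * massRadius β m s ^ 2 + s * K) + 4 * massRadius β m s ^ 2
    + 4 * (momentBound β m s + massRadius β m s ^ 2)

theorem lineConst_pos {β m s K : ℝ} (hm : 0 < m) (hs : 0 ≤ s) (hK : 0 ≤ K) :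
    0 < lineConst β m s K := by
  have h1 := momentBound_nonneg (β := β) (m := m) hs
  have h2 : 0 < massRadius β m s := hm.trans_le (le_massRadius hs)
  unfold lineConst
  positivity

/-- Raising the threshold from m to `massRadius` keeps both tail conditions and secures the mass of
the central interval, so every constant depends on the class alone. -/
theorem ClassM.exists_lintegral_bregman_le {β m s δ K : ℝ} (hβ : 0 ≤ β) (hm : 0 < m) (hs : 0 ≤ s)
    (hδ : 0 ≤ δ) (hδs : δ * s ≤ 1 / 2) (hK : 0 ≤ K) {μ : Measure ℝ} (h : ClassM β m s μ)
    {f f' d : ℝ → ℝ} (hf : ∀ t, HasDerivAt f (f' t) t) (hf' : Continuous f') (hmono : Monotone f')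
    (hd : MonotoneOn d (Set.Ici 0)) (hdsq : ∀ y, 0 ≤ y → y ^ 2 ≤ d y)
    (hP : ∀ x t, massRadius β m s ≤ t → ∀ w, 0 ≤ w → w ≤ 2 * t * |f' x| →
      w * |f' x| ≤ t ^ β * (δ * (w - 1 + Real.exp (-w)) + K * d |f' x|)) :
    ∃ c, ∫⁻ t, ENNReal.ofReal (bregman c (f t)) ∂μ
      ≤ ENNReal.ofReal (lineConst β m s K)
        * ∫⁻ t, ENNReal.ofReal (Real.exp (f t) * d |f' t|) ∂μ := by
  have := h.isProbabilityMeasure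
  have hle := le_massRadius (β := β) (m := m) hs
  exact ModLogSob.exists_lintegral_bregman_le (hm.trans_le hle) hs hδ hδs hK
    (momentBound_nonneg hs) (nuPlus_le_of_le hle h.right_tail)
    (nuPlus_le_of_le hle (h.left_tail_map_neg hm)) (h.lintegral_sq_le hβ hm hs)
    (h.half_le_measure_Icc hβ hm hs) hf hf' hmono hd hdsq hP

/-! ### Convex sections and tensorisation -/

section Sections

variable {n : ℕ}

theorem toLp_update (x : Fin n → ℝ) (i : Fin n) (t : ℝ) :
    (WithLp.toLp 2 (Function.update x i t) : EuclideanSpace ℝ (Fin n))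
      = WithLp.toLp 2 (Function.update x i 0) + t • EuclideanSpace.single i (1 : ℝ) := by
  ext j
  by_cases hj : j = i
  · subst hj
    simp
  · simp [hj]

theorem hasDerivAt_section {φ : EuclideanSpace ℝ (Fin n) → ℝ} (hφ : ContDiff ℝ (⊤ : ℕ∞) φ)
    (x : Fin n → ℝ) (i : Fin n) (t : ℝ) :
    HasDerivAt (fun t => φ (WithLp.toLp 2 (Function.update x i t)))
      (gradient φ (WithLp.toLp 2 (Function.update x i t)) i) t := by
  have hp : HasDerivAt (fun t => (WithLp.toLp 2 (Function.update x i t) : EuclideanSpace ℝ (Fin n)))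
      (EuclideanSpace.single i (1 : ℝ)) t := by
    have h := ((hasDerivAt_id t).smul_const (EuclideanSpace.single i (1 : ℝ))).const_add
      (WithLp.toLp 2 (Function.update x i 0) : EuclideanSpace ℝ (Fin n))
    rw [one_smul] at h
    exact h.congr_of_eventuallyEq (Filter.Eventually.of_forall fun t => toLp_update x i t)
  have hd : DifferentiableAt ℝ φ (WithLp.toLp 2 (Function.update x i t)) :=
    (hφ.differentiable (by simp)) _
  have h := hd.hasFDerivAt.comp_hasDerivAt t hp
  rw [← inner_gradient_left, EuclideanSpace.inner_single_right, one_mul] at h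
  exact h

theorem continuous_gradient {φ : EuclideanSpace ℝ (Fin n) → ℝ} (hφ : ContDiff ℝ (⊤ : ℕ∞) φ) :
    Continuous (gradient φ) := by
  have h : Continuous (fderiv ℝ φ) := hφ.continuous_fderiv (by simp)
  exact (InnerProductSpace.toDual ℝ (EuclideanSpace ℝ (Fin n))).symm.continuous.comp h

theorem monotone_gradient_section {φ : EuclideanSpace ℝ (Fin n) → ℝ}
    (hφ : ContDiff ℝ (⊤ : ℕ∞) φ) (hconv : ConvexOn ℝ Set.univ φ) (x : Fin n → ℝ) (i : Fin n) :
    Monotone fun t => gradient φ (WithLp.toLp 2 (Function.update x i t)) i := by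
  have hder := hasDerivAt_section hφ x i
  have hc : ConvexOn ℝ Set.univ fun t : ℝ => φ (WithLp.toLp 2 (Function.update x i t)) := by
    refine ⟨convex_univ, fun a _ b _ p q hp hq hpq => ?_⟩
    have key := hconv.2 (Set.mem_univ (WithLp.toLp 2 (Function.update x i a)))
      (Set.mem_univ (WithLp.toLp 2 (Function.update x i b))) hp hq hpq
    have e : (WithLp.toLp 2 (Function.update x i (p • a + q • b)) : EuclideanSpace ℝ (Fin n))
        = p • WithLp.toLp 2 (Function.update x i a) + q • WithLp.toLp 2 (Function.update x i b) := by
      ext j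
      by_cases hj : j = i
      · subst hj
        simp
      · simp [hj, ← add_mul, hpq]
    simp only [e]
    exact key
  have := hc.monotoneOn_deriv fun t _ => (hder t).differentiableAt
  intro a b hab
  have h := this (Set.mem_univ a) (Set.mem_univ b) hab
  rwa [(hder a).deriv, (hder b).deriv] at h

/-- The one-dimensional inequality for convex functions tensorises. -/
theorem Ent_le_of_line {Ω : Type*} [MeasurableSpace Ω] {P : Measure Ω} [IsProbabilityMeasure P]
    {X : Fin n → Ω → ℝ} (hX : ∀ i, Measurable (X i)) (hindep : iIndepFun X P)
    {φ : EuclideanSpace ℝ (Fin n) → ℝ} (hφ : ContDiff ℝ (⊤ : ℕ∞) φ)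
    (hconv : ConvexOn ℝ Set.univ φ) {C : ℝ} {Q : ℝ → Prop} (hQ : ∀ i x, Q (gradient φ x i))
    {d : ℝ → ℝ} (hd : Measurable d)
    (hline : ∀ i (f f' : ℝ → ℝ), (∀ t, HasDerivAt f (f' t) t) → Continuous f' → Monotone f' →
      (∀ t, Q (f' t)) → ∃ c, ∫⁻ t, ENNReal.ofReal (bregman c (f t)) ∂(P.map (X i))
        ≤ ENNReal.ofReal C * ∫⁻ t, ENNReal.ofReal (Real.exp (f t) * d |f' t|) ∂(P.map (X i))) :
    Ent P (fun ω => Real.exp (φ (vec X ω))) ≤ ((ENNReal.ofReal C * ∑ i, ∫⁻ ω, ENNReal.ofReal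
      (Real.exp (φ (vec X ω)) * d |gradient φ (vec X ω) i|) ∂P : ℝ≥0∞) : EReal) := by
  have hprob : ∀ i, IsProbabilityMeasure (P.map (X i)) := fun i =>
    Measure.isProbabilityMeasure_map (hX i).aemeasurable
  have hlaw : P.map (fun ω i => X i ω) = Measure.pi fun i => P.map (X i) :=
    (iIndepFun_iff_map_fun_eq_pi_map fun i => (hX i).aemeasurable).1 hindep
  have hXm : Measurable fun ω i => X i ω := measurable_pi_lambda _ hX
  let F : (Fin n → ℝ) → ℝ := fun x => φ (WithLp.toLp 2 x)
  have hto : Measurable fun x : Fin n → ℝ => (WithLp.toLp 2 x : EuclideanSpace ℝ (Fin n)) :=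
    (PiLp.continuous_toLp 2 _).measurable
  have hF : Measurable F := hφ.continuous.measurable.comp hto
  have hgrad : ∀ i, Measurable fun x : Fin n → ℝ =>
      gradient φ (WithLp.toLp 2 x : EuclideanSpace ℝ (Fin n)) i := fun i => by
    have h1 : Continuous fun p : EuclideanSpace ℝ (Fin n) => gradient φ p i :=
      (EuclideanSpace.proj (𝕜 := ℝ) i).continuous.comp (continuous_gradient hφ)
    exact h1.measurable.comp hto
  let T₀ : Fin n → (Fin n → ℝ) → ℝ≥0∞ := fun i x =>
    ENNReal.ofReal (Real.exp (F x) * d |gradient φ (WithLp.toLp 2 x : EuclideanSpace ℝ (Fin n)) i|)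
  have hT₀ : ∀ i, Measurable (T₀ i) := fun i =>
    (hF.exp.mul (hd.comp (continuous_abs.measurable.comp (hgrad i)))).ennreal_ofReal
  have hclamp : ∀ k : ℕ, ENNReal.ofReal (expEnt (Measure.pi fun i => P.map (X i))
      fun x => clamp k (F x)) ≤ ∑ i, ∫⁻ x, ENNReal.ofReal C * T₀ i x
        ∂(Measure.pi fun i => P.map (X i)) := fun k => by
    refine ofReal_expEnt_pi_le (fun i => P.map (X i)) (fun x => clamp k (F x))
      (fun i x => ENNReal.ofReal C * T₀ i x) ((measurable_clamp k).comp hF)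
      (fun x => abs_clamp_le (Nat.cast_nonneg k) _) (fun i => (hT₀ i).const_mul _) fun i x => ?_
    obtain ⟨c, hc⟩ := hline i _ _ (hasDerivAt_section hφ x i)
      (((EuclideanSpace.proj (𝕜 := ℝ) i).continuous.comp (continuous_gradient hφ)).comp
        ((PiLp.continuous_toLp 2 _).comp (continuous_const.update i continuous_id)))
      (monotone_gradient_section hφ hconv x i) fun t => hQ i _
    rw [lintegral_const_mul' _ _ ENNReal.ofReal_ne_top]
    refine le_trans ?_ hc
    have hm : Measurable fun t => clamp k (F (Function.update x i t)) :=
      ((measurable_clamp k).comp hF).comp (measurable_update x)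
    -- The clamped section is no longer convex. The line inequality is used for the unclamped one,
    -- and clamping its base point as well can only lower the divergence.
    refine (ofReal_expEnt_le hm
      (fun t => abs_clamp_le (Nat.cast_nonneg k) _) (clamp k c)).trans ?_
    exact lintegral_mono fun t => ENNReal.ofReal_le_ofReal (bregman_clamp_le _ _ _)
  obtain ⟨c, hc⟩ := exists_lintegral_bregman_le_of_clamp hF hclamp
  refine (Ent_exp_le (hF.comp hXm) c).trans (EReal.coe_ennreal_le_coe_ennreal_iff.2 ?_)
  have hb : Measurable fun x => ENNReal.ofReal (bregman c (F x)) :=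
    ((continuous_bregman c).measurable.comp hF).ennreal_ofReal
  rw [← hlaw, lintegral_map hb hXm] at hc
  refine hc.trans ?_
  rw [Finset.mul_sum]
  refine Finset.sum_le_sum fun i _ => ?_
  rw [lintegral_const_mul' _ _ ENNReal.ofReal_ne_top, lintegral_map (hT₀ i) hXm]
  rfl

/-- Bounding max by sum coordinatewise, then sum by twice the max, costs a factor 2 but nothing in
n. -/
theorem sum_max_le {p : ℝ} (hp : 0 < p) (a : EuclideanSpace ℝ (Fin n)) :
    ∑ i, max (|a i| ^ 2) (|a i| ^ p) ≤ 2 * max (‖a‖ ^ 2) (lpNorm p a ^ p) := by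
  have h1 : lpNorm p a ^ p = ∑ i, |a i| ^ p := by
    rw [lpNorm, ← Real.rpow_mul (Finset.sum_nonneg fun i _ => Real.rpow_nonneg (abs_nonneg _) _),
      one_div_mul_cancel hp.ne', Real.rpow_one]
  have h2 : ‖a‖ ^ 2 = ∑ i, |a i| ^ 2 := by
    rw [EuclideanSpace.norm_sq_eq]
    simp
  calc ∑ i, max (|a i| ^ 2) (|a i| ^ p) ≤ ∑ i, (|a i| ^ 2 + |a i| ^ p) :=
        Finset.sum_le_sum fun i _ => max_le_add_of_nonneg (by positivity)
          (Real.rpow_nonneg (abs_nonneg _) _)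
    _ = ‖a‖ ^ 2 + lpNorm p a ^ p := by rw [Finset.sum_add_distrib, h1, h2]
    _ ≤ _ := by linarith [le_max_left (‖a‖ ^ 2) (lpNorm p a ^ p),
        le_max_right (‖a‖ ^ 2) (lpNorm p a ^ p)]

/-- Summing the contributions of the coordinates. -/
theorem sum_lintegral_le {Ω : Type*} [MeasurableSpace Ω] {P : Measure Ω}
    {X : Fin n → Ω → ℝ} (hX : ∀ i, Measurable (X i))
    {φ : EuclideanSpace ℝ (Fin n) → ℝ} (hφ : ContDiff ℝ (⊤ : ℕ∞) φ)
    {d : ℝ → ℝ} (hd : Measurable d) (hd0 : ∀ y, 0 ≤ y → 0 ≤ d y)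
    {D : EuclideanSpace ℝ (Fin n) → ℝ} {L : ℝ} (hL : 0 ≤ L)
    (hD : ∀ a : EuclideanSpace ℝ (Fin n), ∑ i, d |a i| ≤ L * D a) :
    ∑ i, ∫⁻ ω, ENNReal.ofReal (Real.exp (φ (vec X ω)) * d |gradient φ (vec X ω) i|) ∂P
      ≤ ENNReal.ofReal L * ∫⁻ ω, ENNReal.ofReal
        (D (gradient φ (vec X ω)) * Real.exp (φ (vec X ω))) ∂P := by
  have hvec : Measurable (vec X) :=
    (PiLp.continuous_toLp 2 _).measurable.comp (measurable_pi_lambda _ hX)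
  rw [← lintegral_const_mul' _ _ ENNReal.ofReal_ne_top, ← lintegral_finsetSum]
  · refine lintegral_mono fun ω => ?_
    rw [← ENNReal.ofReal_sum_of_nonneg fun i _ =>
      mul_nonneg (Real.exp_pos _).le (hd0 _ (abs_nonneg _)), ← ENNReal.ofReal_mul hL,
      ← Finset.mul_sum]
    refine ENNReal.ofReal_le_ofReal ?_
    calc _ ≤ Real.exp (φ (vec X ω)) * (L * D (gradient φ (vec X ω))) :=
          mul_le_mul_of_nonneg_left (hD _) (Real.exp_pos _).le
      _ = _ := by ring
  · intro i _
    have h1 : Continuous fun p : EuclideanSpace ℝ (Fin n) => gradient φ p i :=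
      (EuclideanSpace.proj (𝕜 := ℝ) i).continuous.comp (continuous_gradient hφ)
    exact ((hφ.continuous.measurable.comp hvec).exp.mul (hd.comp
      (continuous_abs.measurable.comp (h1.measurable.comp hvec)))).ennreal_ofReal

end Sections

end ModLogSob

/-! ### The theorem: choice of constants in the two regimes -/

theorem theorem1p3 (β m σ : ℝ) (hβ0 : 0 ≤ β) (hβ1 : β ≤ 1) (hm : 0 < m) (hσ : 0 ≤ σ) :
    ∃ C : ℝ, 0 < C ∧
      ∀ (n : ℕ) (Ω : Type*) [MeasurableSpace Ω] (P : Measure Ω) [IsProbabilityMeasure P]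
        (X : Fin n → Ω → ℝ) (φ : EuclideanSpace ℝ (Fin n) → ℝ),
        (∀ i, Measurable (X i)) →
        iIndepFun X P →
        (∀ i, ModLogSob.ClassM β m (σ ^ (β + 1)) (P.map (X i))) →
        ContDiff ℝ (⊤ : ℕ∞) φ →
        ConvexOn ℝ Set.univ φ →
        (0 < β →
          ModLogSob.Ent P (fun ω => Real.exp (φ (ModLogSob.vec X ω))) ≤
            ((ENNReal.ofReal C * ∫⁻ ω, ENNReal.ofReal
              (max (‖gradient φ (ModLogSob.vec X ω)‖ ^ 2)
                  (ModLogSob.lpNorm ((β + 1) / β) (gradient φ (ModLogSob.vec X ω))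
                    ^ ((β + 1) / β))
                * Real.exp (φ (ModLogSob.vec X ω))) ∂P : ℝ≥0∞) : EReal)) ∧
        (β = 0 →
          (∀ (i : Fin n) (x : EuclideanSpace ℝ (Fin n)),
            |gradient φ x i| ≤ 1 / (2 * (m + 3 * σ))) →
          ModLogSob.Ent P (fun ω => Real.exp (φ (ModLogSob.vec X ω))) ≤
            ((ENNReal.ofReal C * ∫⁻ ω, ENNReal.ofReal
              (‖gradient φ (ModLogSob.vec X ω)‖ ^ 2
                * Real.exp (φ (ModLogSob.vec X ω))) ∂P : ℝ≥0∞) : EReal)) := by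
  open ModLogSob in
  rcases hβ0.eq_or_lt with rfl | hβ
  · have hδ : 0 < 3 / (2 * (m + 3 * σ)) := by positivity
    -- Chosen so that δ / 3 is exactly the permitted slope; then δσ ≤ 1/2, as absorption requires.
    set δ := 3 / (2 * (m + 3 * σ)) with hδdef
    have hδσ : δ * σ ^ ((0 : ℝ) + 1) ≤ 1 / 2 := by
      rw [zero_add, Real.rpow_one, hδdef, div_mul_eq_mul_div,
        div_le_div_iff₀ (by positivity) (by positivity)]
      linarith
    have hs : 0 ≤ σ ^ ((0 : ℝ) + 1) := Real.rpow_nonneg hσ _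
    have hK : 0 ≤ 1 / δ := by positivity
    refine ⟨lineConst 0 m (σ ^ ((0 : ℝ) + 1)) (1 / δ), lineConst_pos hm hs hK, ?_⟩
    intro n Ω _ P _ X φ hX hindep hclass hφ hconv
    refine ⟨fun h => absurd h (lt_irrefl 0), fun _ hslope => ?_⟩
    have hmono : MonotoneOn (fun y : ℝ => y ^ 2) (Set.Ici 0) := fun a ha b _ hab =>
      pow_le_pow_left₀ ha hab 2
    refine (Ent_le_of_line hX hindep hφ hconv (Q := fun y => |y| ≤ δ / 3) (fun i x => ?_)
      (d := fun y => y ^ 2) (by fun_prop) fun i f f' hf hf' hfm hfQ =>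
        (hclass i).exists_lintegral_bregman_le le_rfl hm hs hδ.le hδσ hK hf hf' hfm hmono
          (fun _ _ => le_rfl) fun x t ht w hw _ => ?_).trans ?_
    · refine (hslope i x).trans (le_of_eq ?_)
      rw [hδdef]
      field_simp
    · rw [Real.rpow_zero, one_mul]
      exact mul_le_theta_of_le hδ hw (hfQ x)
    · refine EReal.coe_ennreal_le_coe_ennreal_iff.2 (mul_le_mul_right ?_ _)
      have := sum_lintegral_le (P := P) hX hφ (d := fun y => y ^ 2) (by fun_prop)
        (fun y _ => sq_nonneg y) (D := fun a => ‖a‖ ^ 2) zero_le_one fun a => by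
          rw [one_mul, EuclideanSpace.norm_sq_eq]
          simp
      simpa using this
  · have hs : 0 ≤ σ ^ (β + 1) := Real.rpow_nonneg hσ _
    set s := σ ^ (β + 1) with hsdef
    -- The shift s + 1 keeps δ positive and finite also when σ = 0.
    have hδ : 0 < 1 / (2 * (s + 1)) := by positivity
    have hδs : 1 / (2 * (s + 1)) * s ≤ 1 / 2 := by
      rw [div_mul_eq_mul_div, div_le_div_iff₀ (by positivity) (by positivity)]
      linarith
    set δ := 1 / (2 * (s + 1)) with hδdef
    have hR : 0 < massRadius β m s := hm.trans_le (le_massRadius hs)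
    set R := massRadius β m s with hRdef
    set K := 1 / (δ * (R ^ β) ^ 2) + 2 * (3 / δ) ^ ((1 - β) / β) with hKdef
    have hK : 0 ≤ K := by positivity
    have hp : 0 < (β + 1) / β := by positivity
    have hC := lineConst_pos (β := β) hm hs hK
    -- The factor 2 pays for `sum_max_le`.
    refine ⟨lineConst β m s K * 2, by positivity, ?_⟩
    intro n Ω _ P _ X φ hX hindep hclass hφ hconv
    refine ⟨fun _ => ?_, fun h => absurd h hβ.ne'⟩
    have hmono : MonotoneOn (fun y : ℝ => max (y ^ 2) (y ^ ((β + 1) / β))) (Set.Ici 0) :=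
      fun a ha b _ hab => max_le_max (pow_le_pow_left₀ ha hab 2)
        (Real.rpow_le_rpow ha hab hp.le)
    have hdm : Measurable fun y : ℝ => max (y ^ 2) (y ^ ((β + 1) / β)) := by fun_prop
    refine (Ent_le_of_line hX hindep hφ hconv (Q := fun _ => True) (fun _ _ => trivial)
      hdm fun i f f' hf hf' hfm _ =>
        (hclass i).exists_lintegral_bregman_le hβ0 hm hs hδ.le hδs hK hf hf' hfm hmono
          (fun _ _ => le_max_left _ _) fun x t ht w hw hwt =>
            mul_le_theta_of_pos hβ hβ1 hR hδ ht hw (abs_nonneg _) hwt).trans ?_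
    refine EReal.coe_ennreal_le_coe_ennreal_iff.2 ?_
    rw [ENNReal.ofReal_mul hC.le, mul_assoc]
    refine mul_le_mul_right ?_ _
    exact sum_lintegral_le hX hφ hdm (fun y _ => le_max_of_le_left (sq_nonneg y))
      (D := fun a => max (‖a‖ ^ 2) (lpNorm ((β + 1) / β) a ^ ((β + 1) / β))) zero_le_two
      fun a => sum_max_le hp a
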